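/- Let $n\ge 1$, let $T>0$ be a prescribed time, let $c_0\in\mathbb R$ be a known constant, and let $c_{ij}$ ($1\le j\le i\le n$) be known real constants. Consider the uncertain nonholonomic system with state $(x_0,x)$, $x=(x_1,\dots,x_n)^{\mathrm T}$, and controls $u_0,u\in\mathbb R$, $$\dot x_0=u_0+c_0x_0,\qquad \dot x_i=u_0x_{i+1}+\phi_i(t,u,x)\ (1\le i\le n-1),\qquad \dot x_n=u+\phi_n(t,u,x),$$ where the unknown functions $\phi_i$ are continuous and satisfy $|\phi_i(t,u,x)|\le\sum_{j=1}^{i}c_{ij}|x_j|$. **Notation.** Let $A\in\mathbb R^{n\times n}$ be the matrix with ones on the superdiagonal and zeros elsewhere, $b=(0,\dots,0,1)^{\mathrm T}$, $L_n(\gamma)=\mathrm{diag}\{\gamma^{n-1},\gamma^{n-2},\dots,1\}$ and $E_n=\mathrm{diag}\{n-1,n-2,\dots,0\}$. For $\gamma>0$ let $P(\gamma)$ be the unique positive definite solution of $A^{\mathrm T}P+PA-Pbb^{\mathrm T}P=-\gamma P$. Put $P_n=P(1)$, $\delta_{\mathrm c}=n\bigl(1+\lambda_{\max}(E_n+P_nE_nP_n^{-1})\bigr)$,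 $\Lambda=\lambda_{\max}(P_n)$, $\gamma_0=1/T$, $g_{ij}=c_{ij}T^{i+1-j}$ for $j<i$, $g_{ii}=c_{ii}T+n-i$, $$d=\Bigl(\max_{1\le j\le n}\sum_{i=j}^{n}\frac{g_{ij}^2\,i}{\gamma_0^{2(i-j)}}\Bigr)^{1/2},\qquad \beta=\frac{(2n+\delta_{\mathrm c})\,e^{|c_0|T}}{n}+2d\Lambda e^{|c_0|T}.$$ **Claim.** The time-varying feedback $$u_0=-\frac{3}{T-t}x_0-\frac{\beta}{2}e^{c_0t}(T-t),\qquad u=-\beta e^{c_0t}\,b^{\mathrm T}P(\gamma(t))\,L_n\!\Bigl(\frac1{T-t}\Bigr)x,\qquad \gamma(t)=\frac{T}{T-t}\gamma_0,$$ is smooth in $(t,x_0,x)$ for $t\in[0,T)$, and there are positive constants $\upsilon_{11},\upsilon_{12},\upsilon_{21},\upsilon_{22}$, depending only on $n,T,c_0,(c_{ij})$, such that for all such $\phi_i$ and any initial condition, every solution of the closed-loop system on an interval $[0,\tau)$ with $\tau\le T$ satisfies, for all $t\in[0,\tau)$ (in particular for all $t\in[0,T)$ if $\tau=T$), $$|x_0(t)|\le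 (T-t)^2e^{c_0t}\Bigl(\frac{(T-t)|x_0(0)|}{T^3}+\frac{\beta t}{2T}\Bigr),$$ $$|u_0(t)|\le (T-t)e^{c_0t}\Bigl(3(T-t)\Bigl(\frac{|x_0(0)|}{T^3}+\frac{\beta}{2T}\Bigr)+\beta\Bigr),$$ $$\|x(t)\|\le\upsilon_{11}(T-t)^{3/2}e^{\upsilon_{12}|x_0(0)|t}\|x(0)\|,$$ $$|u(t)|\le\upsilon_{21}(T-t)^{1/2}e^{\upsilon_{22}|x_0(0)|t}\|x(0)\|,$$ where $\|\cdot\|$ is the Euclidean norm. Consequently, along every solution on $[0,T)$, the states $x_0(t),x(t)$ and the controls $u_0(t),u(t)$ converge to $0$ as $t\to T^-$. -/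

import Mathlib

open Set Filter Topology Matrix
open scoped ContDiff

namespace PrescribedTime

noncomputable section

/-- The `n × n` upper shift matrix, with ones on the superdiagonal. -/
def shiftA (n : ℕ) : Matrix (Fin n) (Fin n) ℝ :=
  Matrix.of fun i j => if (i : ℕ) + 1 = (j : ℕ) then 1 else 0

/-- The last standard basis vector of `ℝⁿ`. -/
def inputB (n : ℕ) : Fin n → ℝ :=
  fun i => if (i : ℕ) + 1 = n then 1 else 0

/-- `L_n(γ) = diag(γ^(n-1), γ^(n-2), …, 1)`. -/
def scaleL (n : ℕ) (γ : ℝ) : Matrix (Fin n) (Fin n) ℝ :=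
  Matrix.diagonal fun i => γ ^ (n - 1 - (i : ℕ))

/-- `E_n = diag(n-1, n-2, …, 1, 0)`. -/
def diagE (n : ℕ) : Matrix (Fin n) (Fin n) ℝ :=
  Matrix.diagonal fun i => ((n - 1 - (i : ℕ) : ℕ) : ℝ)

/-- `P` is a positive definite solution of the parametric Lyapunov equation
`Aᵀ P + P A - P b bᵀ P = -γ P`. -/
def IsPLESolution (n : ℕ) (γ : ℝ) (P : Matrix (Fin n) (Fin n) ℝ) : Prop :=
  P.PosDef ∧
    (shiftA n)ᵀ * P + P * shiftA n - P * Matrix.vecMulVec (inputB n) (inputB n) * P = -(γ • P)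

/-- `P(γ)`: the positive definite solution of the parametric Lyapunov equation
(it exists and is unique for every `γ > 0`). -/
def pleP (n : ℕ) (γ : ℝ) : Matrix (Fin n) (Fin n) ℝ :=
  Classical.epsilon (IsPLESolution n γ)

/-- The maximal (real) eigenvalue of a matrix. It is used only for matrices all of whose
eigenvalues are real. -/
def lambdaMax {n : ℕ} (M : Matrix (Fin n) (Fin n) ℝ) : ℝ :=
  sSup (spectrum ℝ M)

/-- `δ_c = n (1 + λ_max(E_n + P_n E_n P_n⁻¹))` with `P_n = P(1)`. -/
def deltaC (n : ℕ) : ℝ :=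
  n * (1 + lambdaMax (diagE n + pleP n 1 * diagE n * (pleP n 1)⁻¹))

/-- `Λ = λ_max(P_n)` with `P_n = P(1)`. -/
def bigLambda (n : ℕ) : ℝ :=
  lambdaMax (pleP n 1)

/-- With one-based indices: `g_ij = c_ij T^(i+1-j)` for `j < i`, and `g_ii = c_ii T + n - i`.
Only entries with `j ≤ i` are used. -/
def gCoef {n : ℕ} (T : ℝ) (c : Fin n → Fin n → ℝ) (i j : Fin n) : ℝ :=
  if i = j then c i i * T + ((n : ℝ) - ((i : ℕ) + 1))
  else c i j * T ^ ((i : ℕ) + 1 - (j : ℕ))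

/-- The constant `d ≥ 0` given (with one-based indices) by
`d² = max_j ∑_{i ≥ j} g_ij² i / γ₀^(2(i-j))`, where `γ₀ = 1/T`. -/
def dConst {n : ℕ} (T : ℝ) (c : Fin n → Fin n → ℝ) : ℝ :=
  Real.sqrt (⨆ j : Fin n, ∑ i ∈ Finset.Ici j,
    gCoef T c i j ^ 2 * ((i : ℕ) + 1 : ℝ) / (1 / T) ^ (2 * ((i : ℕ) - (j : ℕ))))

/-- The gain `β = (2n + δ_c) e^{|c₀|T} / n + 2 d Λ e^{|c₀|T}`. -/
def gainBeta {n : ℕ} (T c₀ : ℝ) (c : Fin n → Fin n → ℝ) : ℝ :=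
  (2 * n + deltaC n) * Real.exp (|c₀| * T) / n
    + 2 * dConst T c * bigLambda n * Real.exp (|c₀| * T)

/-- `γ(t) = T γ₀ / (T - t)` with `γ₀ = 1/T`. -/
def gammaFun (T t : ℝ) : ℝ :=
  T / (T - t) * (1 / T)

/-- The feedback `u₀ = -3 x₀ / (T - t) - (β/2) e^{c₀ t} (T - t)`. -/
def feedbackU0 {n : ℕ} (T c₀ : ℝ) (c : Fin n → Fin n → ℝ) (t x₀ : ℝ) : ℝ :=
  -(3 / (T - t)) * x₀ - gainBeta T c₀ c / 2 * Real.exp (c₀ * t) * (T - t)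

/-- The feedback `u = -β e^{c₀ t} bᵀ P(γ(t)) L_n(1/(T-t)) x`. -/
def feedbackU {n : ℕ} (T c₀ : ℝ) (c : Fin n → Fin n → ℝ) (t : ℝ)
    (x : EuclideanSpace ℝ (Fin n)) : ℝ :=
  -(gainBeta T c₀ c * Real.exp (c₀ * t) *
    (inputB n ⬝ᵥ (pleP n (gammaFun T t) *ᵥ (scaleL n (1 / (T - t)) *ᵥ fun i => x i))))

/-- The standing assumption on the unknown nonlinearities: on `[0, T)` they are continuous and
`|φ_i(t,u,x)| ≤ c_i1 |x_1| + ⋯ + c_ii |x_i|`. -/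
def AdmissibleNonlinearity {n : ℕ} (T : ℝ) (c : Fin n → Fin n → ℝ)
    (φ : Fin n → ℝ → ℝ → EuclideanSpace ℝ (Fin n) → ℝ) : Prop :=
  ∀ i : Fin n,
    ContinuousOn (fun p : ℝ × ℝ × EuclideanSpace ℝ (Fin n) => φ i p.1 p.2.1 p.2.2)
      (Ico 0 T ×ˢ univ) ∧
    ∀ t ∈ Ico 0 T, ∀ (u : ℝ) (x : EuclideanSpace ℝ (Fin n)),
      |φ i t u x| ≤ ∑ j ∈ Finset.Iic i, c i j * |x j|

/-- Right-hand side of the `x`-subsystem: `u₀ x_{i+1} + φ_i(t,u,x)` for `i < n`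
and `u + φ_n(t,u,x)` for `i = n` (one-based indices). -/
def chainedRHS {n : ℕ} (φ : Fin n → ℝ → ℝ → EuclideanSpace ℝ (Fin n) → ℝ)
    (t u₀ u : ℝ) (x : EuclideanSpace ℝ (Fin n)) (i : Fin n) : ℝ :=
  (if h : (i : ℕ) + 1 < n then u₀ * x ⟨(i : ℕ) + 1, h⟩ else u) + φ i t u x

/-- `(x₀, x)` solves on `[0, τ)` the closed loop of `x₀' = u₀ + c₀ x₀`, the chained
`x`-subsystem, and the feedback laws `feedbackU0`, `feedbackU`. At `t = 0` the derivative
is one-sided. -/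
def IsClosedLoopSolution {n : ℕ} (T c₀ : ℝ) (c : Fin n → Fin n → ℝ)
    (φ : Fin n → ℝ → ℝ → EuclideanSpace ℝ (Fin n) → ℝ) (τ : ℝ)
    (x₀ : ℝ → ℝ) (x : ℝ → EuclideanSpace ℝ (Fin n)) : Prop :=
  ∀ t ∈ Ico 0 τ,
    HasDerivWithinAt x₀ (feedbackU0 T c₀ c t (x₀ t) + c₀ * x₀ t) (Ico 0 τ) t ∧
    ∀ i : Fin n, HasDerivWithinAt (fun s => x s i)
      (chainedRHS φ t (feedbackU0 T c₀ c t (x₀ t)) (feedbackU T c₀ c t (x t)) (x t) i)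
      (Ico 0 τ) t

end

end PrescribedTime

open PrescribedTime

namespace PrescribedTime

noncomputable section

/-! ### The parametric Lyapunov equation -/

/-! The first equation is scalar and linear: `e^{-c₀t}(T-t)⁻³x₀ + (β/2)(T-t)⁻¹` is conserved. Hence
`x₀` is explicit and `u₀ = e(T-t)(β - (T-t)k)`, where `e = e^{c₀t}` and `k` is a constant affine in
`x₀(0)` (`x0_formula`, `feedbackU0_formula`).

Put `g = 1/(T-t)`, `P = P(1)` and `y = L_n(g)²x`. The closed loop becomes `y' = e(βg - k)Ay -
βeg(bᵀPy)b + g(Ey + F)`. Differentiating `L_n(g)²` yields `2gEy`; one copy of `Ey` stays and the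
other joins the nonlinearity in `F`, with `‖F‖ ≤ d‖y‖`. Let `V = yᵀPy`. The Lyapunov equation gives
`2yᵀPAy = (bᵀPy)² - V`, so the terms carrying `β` contribute at most `-βegV`, while `Ey` and `F`
cost at most `λ_E gV` and `2dΛgV`. The gain is chosen so that `βe ≥ 3 + λ_E + 2dΛ`, leaving `V' ≤
(-3g + M)V` with `M` constant, hence `V ≤ C(T-t)³e^{Mt}` (`energy_derivative_le`,
`le_of_deriv_le_of_prescribed`). Square roots give the rate `3/2` for `x`; the control has an extra
factor `g`, hence `1/2`.

The spectral constants rest on `P = RᵀR`, with `R` the signed Pascal matrix and `R² = 1`. This gives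
`‖y‖² ≤ ΛV` with the same `Λ` that bounds `P` above, and makes `E + PEP⁻¹` similar to a symmetric
matrix. -/

theorem shiftA_mul_apply {n : ℕ} (W : Matrix (Fin n) (Fin n) ℝ) (i j : Fin n) :
    (shiftA n * W) i j = if h : (i : ℕ) + 1 < n then W ⟨i + 1, h⟩ j else 0 := by
  rw [Matrix.mul_apply]
  split_ifs with h
  · rw [Finset.sum_eq_single ⟨i + 1, h⟩]
    · simp [shiftA]
    · intro k _ hk
      have : ¬ ((i : ℕ) + 1 = k) := fun h' => hk (Fin.ext h'.symm)
      simp [shiftA, this]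
    · simp
  · refine Finset.sum_eq_zero fun k _ => ?_
    have : ¬ ((i : ℕ) + 1 = k) := by have := k.2; omega
    simp [shiftA, this]

theorem mul_shiftA_transpose_apply {n : ℕ} (W : Matrix (Fin n) (Fin n) ℝ) (i j : Fin n) :
    (W * (shiftA n)ᵀ) i j = if h : (j : ℕ) + 1 < n then W i ⟨j + 1, h⟩ else 0 := by
  have := shiftA_mul_apply Wᵀ j i
  rw [← Matrix.transpose_apply (W * (shiftA n)ᵀ), Matrix.transpose_mul, Matrix.transpose_transpose,
    this]
  rfl

theorem shiftA_mulVec_apply {n : ℕ} (y : Fin n → ℝ) (i : Fin n) :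
    (shiftA n *ᵥ y) i = if h : (i : ℕ) + 1 < n then y ⟨i + 1, h⟩ else 0 := by
  have := shiftA_mul_apply (Matrix.of fun k (_ : Fin n) => y k) i i
  simpa [Matrix.mul_apply, Matrix.mulVec, dotProduct] using this

/-- The signed Pascal matrix, an involution which factors the solution of the parametric
Lyapunov equation. -/
def signedPascal (n : ℕ) : Matrix (Fin n) (Fin n) ℝ :=
  Matrix.of fun i j => (-1) ^ (n - 1 - (i : ℕ)) * ((n - 1 - (i : ℕ)).choose (n - 1 - (j : ℕ)) : ℝ)

theorem sum_fin_reflect {n : ℕ} (f : ℕ → ℝ) :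
    ∑ k : Fin n, f (n - 1 - (k : ℕ)) = ∑ k ∈ Finset.range n, f k := by
  rw [← Finset.sum_range_reflect, Finset.sum_range]

/-- Binomial inversion: `C(a,k)C(k,c) = C(a,c)C(a-c,k-c)` reduces the sum to an alternating row sum
of Pascal's triangle, which vanishes unless `a = c`. -/
theorem alternating_sum_choose_mul_choose {N a c : ℕ} (ha : a < N) :
    ∑ k ∈ Finset.range N, (-1 : ℝ) ^ k * (a.choose k * k.choose c) =
      if a = c then (-1) ^ c else 0 := by
  rcases lt_or_ge a c with hac | hac
  · rw [if_neg hac.ne]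
    refine Finset.sum_eq_zero fun k _ => ?_
    rcases lt_or_ge a k with h | h
    · simp [Nat.choose_eq_zero_of_lt h]
    · simp [Nat.choose_eq_zero_of_lt (h.trans_lt hac)]
  · have h1 : ∑ k ∈ Finset.range N, (-1 : ℝ) ^ k * (a.choose k * k.choose c) =
        ∑ k ∈ Finset.Ico c (a + 1), (-1 : ℝ) ^ k * (a.choose k * k.choose c) := by
      symm
      refine Finset.sum_subset (fun k hk => ?_) fun k _ hk => ?_
      · simp only [Finset.mem_Ico, Finset.mem_range] at hk ⊢; omega
      · simp only [Finset.mem_Ico, not_and_or, not_le, not_lt] at hk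
        rcases hk with h | h
        · simp [Nat.choose_eq_zero_of_lt h]
        · simp [Nat.choose_eq_zero_of_lt (show a < k by omega)]
    rw [h1, Finset.sum_Ico_eq_sum_range, show a + 1 - c = (a - c) + 1 by omega]
    have h2 : ∀ l ∈ Finset.range (a - c + 1),
        (-1 : ℝ) ^ (c + l) * (a.choose (c + l) * (c + l).choose c) =
          (-1) ^ c * a.choose c * ((-1) ^ l * ((a - c).choose l : ℝ)) := by
      intro l _
      have := Nat.choose_mul (n := a) (k := c + l) (s := c) (by omega)
      rw [Nat.add_sub_cancel_left] at this
      have h3 : (a.choose (c + l) * (c + l).choose c : ℝ) = a.choose c * (a - c).choose l := by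
        exact_mod_cast this
      rw [h3, pow_add]; ring
    rw [Finset.sum_congr rfl h2, ← Finset.mul_sum]
    have h4 : ∑ l ∈ Finset.range (a - c + 1), (-1 : ℝ) ^ l * ((a - c).choose l : ℝ) =
        if a - c = 0 then 1 else 0 := by
      have := Int.alternating_sum_range_choose (n := a - c)
      exact_mod_cast this
    rw [h4]
    by_cases h : a = c
    · subst h; simp
    · rw [if_neg h, if_neg (by omega), mul_zero]

theorem signedPascal_mul_self (n : ℕ) : signedPascal n * signedPascal n = 1 := by
  ext i j
  rw [Matrix.mul_apply]
  -- An opaque `f` keeps the summand in the form `f (n - 1 - k)` needed for reflecting the index.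
  obtain ⟨f, hf⟩ : ∃ f : ℕ → ℝ, f = fun k => (-1 : ℝ) ^ k *
      ((n - 1 - (i : ℕ)).choose k * k.choose (n - 1 - (j : ℕ))) := ⟨_, rfl⟩
  have h1 : ∀ k : Fin n, signedPascal n i k * signedPascal n k j =
      (-1) ^ (n - 1 - (i : ℕ)) * f (n - 1 - (k : ℕ)) := by
    intro k; simp only [hf, signedPascal, Matrix.of_apply]; ring
  rw [Finset.sum_congr rfl fun k _ => h1 k, ← Finset.mul_sum, sum_fin_reflect f, hf,
    alternating_sum_choose_mul_choose (by have := i.2; omega), Matrix.one_apply]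
  by_cases h : i = j
  · subst h; simp [← pow_add]
  · rw [if_neg h, if_neg, mul_zero]
    intro h'; apply h; apply Fin.ext; have := i.2; have := j.2; omega

/-- Vandermonde's identity, with indices counted from the last row and column. -/
theorem signedPascal_mul_transpose_apply {n : ℕ} (i j : Fin n) :
    (signedPascal n * (signedPascal n)ᵀ) i j = (-1) ^ ((n - 1 - (i : ℕ)) + (n - 1 - (j : ℕ))) *
      (((n - 1 - (i : ℕ)) + (n - 1 - (j : ℕ))).choose (n - 1 - (i : ℕ)) : ℝ) := by
  rw [Matrix.mul_apply]
  set a := n - 1 - (i : ℕ) with ha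
  set b := n - 1 - (j : ℕ)
  obtain ⟨f, hf⟩ : ∃ f : ℕ → ℝ, f = fun k => (a.choose k : ℝ) * b.choose k := ⟨_, rfl⟩
  have h1 : ∀ k : Fin n, signedPascal n i k * (signedPascal n)ᵀ k j =
      (-1) ^ (a + b) * f (n - 1 - (k : ℕ)) := by
    intro k; simp only [hf, signedPascal, Matrix.of_apply, Matrix.transpose_apply, pow_add]; ring
  rw [Finset.sum_congr rfl fun k _ => h1 k, ← Finset.mul_sum, sum_fin_reflect f, hf, Nat.add_choose_eq,
    Finset.Nat.sum_antidiagonal_eq_sum_range_succ_mk]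
  congr 1
  push_cast
  have h2 : Finset.range (a + 1) ⊆ Finset.range n := by
    intro k; have := i.2; simp only [Finset.mem_range]; omega
  rw [← Finset.sum_subset h2]
  · rw [← Finset.sum_range_reflect]
    refine Finset.sum_congr rfl fun k hk => ?_
    have hk' : k ≤ a := by simpa [Nat.lt_succ_iff] using hk
    rw [show a + 1 - 1 - k = a - k by omega, Nat.choose_symm hk']
  · intro k _ hk
    have : a < k := by simpa [Nat.lt_succ_iff] using hk
    simp [Nat.choose_eq_zero_of_lt this]

/-- With `a`, `b` the distances to the last row and column, the entries are `±C(a+b,a)` and each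
shift lowers one of `a`, `b`: the equation is Pascal's rule. On the border a shift term disappears;
at the corner `a = b = 0` the input matrix supplies the 1. -/
theorem signedPascal_lyapunov (n : ℕ) :
    shiftA n * (signedPascal n * (signedPascal n)ᵀ) +
      (signedPascal n * (signedPascal n)ᵀ) * (shiftA n)ᵀ -
      Matrix.vecMulVec (inputB n) (inputB n) = -(signedPascal n * (signedPascal n)ᵀ) := by
  ext i j
  have hi := i.2
  have hj := j.2
  rw [Matrix.sub_apply, Matrix.add_apply, Matrix.neg_apply, shiftA_mul_apply,
    mul_shiftA_transpose_apply, Matrix.vecMulVec_apply]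
  simp only [signedPascal_mul_transpose_apply, inputB]
  by_cases h1 : (i : ℕ) + 1 < n <;> by_cases h2 : (j : ℕ) + 1 < n
  · obtain ⟨a, ha⟩ : ∃ a, n - 1 - (i : ℕ) = a + 1 := ⟨n - 1 - i - 1, by omega⟩
    obtain ⟨b, hb⟩ : ∃ b, n - 1 - (j : ℕ) = b + 1 := ⟨n - 1 - j - 1, by omega⟩
    have ha' : n - 1 - ((i : ℕ) + 1) = a := by omega
    have hb' : n - 1 - ((j : ℕ) + 1) = b := by omega
    have := Nat.choose_succ_succ (a + b + 1) a
    have h3 : ((a + 1 + (b + 1)).choose (a + 1) : ℝ) =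
        (a + (b + 1)).choose a + (a + 1 + b).choose (a + 1) := by
      rw [show a + 1 + (b + 1) = (a + b + 1).succ by omega, show a + (b + 1) = a + b + 1 by omega,
        show a + 1 + b = a + b + 1 by omega]
      exact_mod_cast this
    simp only [h1, h2, dite_true, h1.ne, if_false, ha, hb, ha', hb', h3]
    ring
  · obtain ⟨a, ha⟩ : ∃ a, n - 1 - (i : ℕ) = a + 1 := ⟨n - 1 - i - 1, by omega⟩
    have hb : n - 1 - (j : ℕ) = 0 := by omega
    have ha' : n - 1 - ((i : ℕ) + 1) = a := by omega
    simp [h1, h2, h1.ne, ha, hb, ha', pow_succ]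
  · obtain ⟨b, hb⟩ : ∃ b, n - 1 - (j : ℕ) = b + 1 := ⟨n - 1 - j - 1, by omega⟩
    have ha : n - 1 - (i : ℕ) = 0 := by omega
    have hb' : n - 1 - ((j : ℕ) + 1) = b := by omega
    simp [h1, h2, h2.ne, ha, hb, hb', pow_succ]
  · have ha : n - 1 - (i : ℕ) = 0 := by omega
    have hb : n - 1 - (j : ℕ) = 0 := by omega
    have h1' : (i : ℕ) + 1 = n := by omega
    have h2' : (j : ℕ) + 1 = n := by omega
    simp [h1', h2', ha, hb]

/-- The positive definite solution `P(1)`, in factored form. -/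
def pascalP (n : ℕ) : Matrix (Fin n) (Fin n) ℝ := (signedPascal n)ᵀ * signedPascal n

theorem signedPascal_transpose_mul_self (n : ℕ) :
    (signedPascal n)ᵀ * (signedPascal n)ᵀ = 1 := by
  rw [← Matrix.transpose_mul, signedPascal_mul_self, Matrix.transpose_one]

theorem pascalP_mul_inv (n : ℕ) :
    pascalP n * (signedPascal n * (signedPascal n)ᵀ) = 1 := by
  rw [pascalP, Matrix.mul_assoc, ← Matrix.mul_assoc (signedPascal n), signedPascal_mul_self,
    Matrix.one_mul, signedPascal_transpose_mul_self]

theorem pascalP_posDef (n : ℕ) : (pascalP n).PosDef := by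
  refine Matrix.PosDef.conjTranspose_mul_self (signedPascal n) ?_
  intro v w h
  have : signedPascal n *ᵥ (signedPascal n *ᵥ v) = signedPascal n *ᵥ (signedPascal n *ᵥ w) := by
    rw [show signedPascal n *ᵥ v = signedPascal n *ᵥ w from h]
  simpa [Matrix.mulVec_mulVec, signedPascal_mul_self] using this

/-- If `W` inverts `P`, the Lyapunov equation for `W` is equivalent to the one for `P`. -/
theorem ple_iff_inverse {n : ℕ} {γ : ℝ} {P W : Matrix (Fin n) (Fin n) ℝ} (hPW : P * W = 1) :
    ((shiftA n)ᵀ * P + P * shiftA n - P * Matrix.vecMulVec (inputB n) (inputB n) * P = -(γ • P)) ↔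
    shiftA n * W + W * (shiftA n)ᵀ - Matrix.vecMulVec (inputB n) (inputB n) = -(γ • W) := by
  have hWP : W * P = 1 := mul_eq_one_comm.mp hPW
  set A := shiftA n
  set B := Matrix.vecMulVec (inputB n) (inputB n)
  have hr : ∀ X : Matrix (Fin n) (Fin n) ℝ, X * P * W = X := fun X => by
    rw [Matrix.mul_assoc, hPW, Matrix.mul_one]
  have hr' : ∀ X : Matrix (Fin n) (Fin n) ℝ, X * W * P = X := fun X => by
    rw [Matrix.mul_assoc, hWP, Matrix.mul_one]
  constructor
  · intro h
    -- Conjugating by the inverse makes the quadratic equation linear, since `W(PBP)W = B`.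
    have := congrArg (fun X => W * X * W) h
    simp only [Matrix.mul_sub, Matrix.sub_mul, Matrix.mul_add, Matrix.add_mul, Matrix.mul_neg,
      Matrix.neg_mul, Matrix.mul_smul, Matrix.smul_mul, ← Matrix.mul_assoc, hr, hWP,
      Matrix.one_mul] at this
    rw [← this]; abel
  · intro h
    have := congrArg (fun X => P * X * P) h
    simp only [Matrix.mul_sub, Matrix.sub_mul, Matrix.mul_add, Matrix.add_mul, Matrix.mul_neg,
      Matrix.neg_mul, Matrix.mul_smul, Matrix.smul_mul, ← Matrix.mul_assoc, hr', hPW,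
      Matrix.one_mul] at this
    rw [← this]; abel

/-- The shift is nilpotent: both terms on the left are entries strictly closer to the bottom right
corner, so induction on that distance leaves `γ D i j = 0`. -/
theorem lyapunov_kernel_trivial {n : ℕ} {γ : ℝ} (hγ : γ ≠ 0) {D : Matrix (Fin n) (Fin n) ℝ}
    (h : shiftA n * D + D * (shiftA n)ᵀ = -(γ • D)) : D = 0 := by
  have key : ∀ s : ℕ, ∀ i j : Fin n, (n - 1 - (i : ℕ)) + (n - 1 - (j : ℕ)) = s → D i j = 0 := by
    intro s
    induction s using Nat.strong_induction_on with
    | _ s ih =>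
      intro i j hs
      have h1 := congrFun (congrFun h i) j
      rw [Matrix.add_apply, shiftA_mul_apply, mul_shiftA_transpose_apply] at h1
      have e1 : (if h : (i : ℕ) + 1 < n then D ⟨i + 1, h⟩ j else 0) = 0 := by
        split_ifs with hi
        · exact ih ((n - 1 - ((i : ℕ) + 1)) + (n - 1 - (j : ℕ))) (by omega) ⟨i + 1, hi⟩ j rfl
        · rfl
      have e2 : (if h : (j : ℕ) + 1 < n then D i ⟨j + 1, h⟩ else 0) = 0 := by
        split_ifs with hj
        · exact ih ((n - 1 - (i : ℕ)) + (n - 1 - ((j : ℕ) + 1))) (by omega) i ⟨j + 1, hj⟩ rfl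
        · rfl
      rw [e1, e2] at h1
      simpa [hγ] using h1
  ext i j
  exact key _ i j rfl

/-- Inverses of solutions satisfy a linear equation, so their difference lies in a trivial kernel.
-/
theorem IsPLESolution.unique {n : ℕ} {γ : ℝ} (hγ : γ ≠ 0) {P Q : Matrix (Fin n) (Fin n) ℝ}
    (hP : IsPLESolution n γ P) (hQ : IsPLESolution n γ Q) : P = Q := by
  have uP := (Matrix.isUnit_iff_isUnit_det _).mp hP.1.isUnit
  have uQ := (Matrix.isUnit_iff_isUnit_det _).mp hQ.1.isUnit
  have h1 := (ple_iff_inverse (Matrix.mul_nonsing_inv P uP)).mp hP.2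
  have h2 := (ple_iff_inverse (Matrix.mul_nonsing_inv Q uQ)).mp hQ.2
  have h3 : P⁻¹ - Q⁻¹ = 0 := by
    apply lyapunov_kernel_trivial hγ
    rw [Matrix.mul_sub, Matrix.sub_mul, smul_sub, neg_sub]
    calc _ = (shiftA n * P⁻¹ + P⁻¹ * (shiftA n)ᵀ - Matrix.vecMulVec (inputB n) (inputB n)) -
          (shiftA n * Q⁻¹ + Q⁻¹ * (shiftA n)ᵀ - Matrix.vecMulVec (inputB n) (inputB n)) := by abel
      _ = _ := by rw [h1, h2]; abel
  have h4 : P⁻¹ = Q⁻¹ := sub_eq_zero.mp h3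
  rw [← Matrix.nonsing_inv_nonsing_inv P uP, h4, Matrix.nonsing_inv_nonsing_inv Q uQ]

theorem isPLESolution_pascalP (n : ℕ) : IsPLESolution n 1 (pascalP n) := by
  refine ⟨pascalP_posDef n, (ple_iff_inverse (pascalP_mul_inv n)).mpr ?_⟩
  rw [one_smul]
  exact signedPascal_lyapunov n

theorem scaleL_mul_shiftA (n : ℕ) (γ : ℝ) :
    scaleL n γ * shiftA n = γ • (shiftA n * scaleL n γ) := by
  ext i j
  rw [scaleL, Matrix.diagonal_mul, Matrix.smul_apply, Matrix.mul_diagonal]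
  simp only [shiftA, Matrix.of_apply, smul_eq_mul]
  split_ifs with h
  · have := j.2
    rw [show n - 1 - (i : ℕ) = (n - 1 - (j : ℕ)) + 1 by omega, pow_succ]; ring
  · simp

theorem scaleL_mulVec_inputB (n : ℕ) (γ : ℝ) : scaleL n γ *ᵥ inputB n = inputB n := by
  ext i
  rw [scaleL, Matrix.mulVec_diagonal]
  simp only [inputB]
  split_ifs with h
  · rw [show n - 1 - (i : ℕ) = 0 by omega]; simp
  · simp

theorem scaleL_transpose (n : ℕ) (γ : ℝ) : (scaleL n γ)ᵀ = scaleL n γ :=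
  Matrix.diagonal_transpose _

theorem scaleL_mul_input (n : ℕ) (γ : ℝ) :
    scaleL n γ * Matrix.vecMulVec (inputB n) (inputB n) * scaleL n γ =
      Matrix.vecMulVec (inputB n) (inputB n) := by
  rw [Matrix.mul_vecMulVec, Matrix.vecMulVec_mul, scaleL_mulVec_inputB]
  congr 1
  rw [← Matrix.mulVec_transpose, scaleL_transpose, scaleL_mulVec_inputB]

/-- Since `LA = γAL` and `Lb = b`, every term of the equation at `γ` is `γ²` times the `L`-conjugate
of the corresponding term at 1. -/
theorem isPLESolution_scaled (n : ℕ) {γ : ℝ} (hγ : 0 < γ) :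
    IsPLESolution n γ (γ • (scaleL n γ * pascalP n * scaleL n γ)) := by
  have hA := scaleL_mul_shiftA n γ
  have hA' : (shiftA n)ᵀ * scaleL n γ = γ • (scaleL n γ * (shiftA n)ᵀ) := by
    have := congrArg Matrix.transpose hA
    simpa [Matrix.transpose_mul, scaleL_transpose] using this
  have hB := scaleL_mul_input n γ
  constructor
  · have h : ((scaleL n γ)ᴴ * pascalP n * scaleL n γ).PosDef := by
      refine (pascalP_posDef n).conjTranspose_mul_mul_same ?_
      intro v w h
      ext i
      have := congrFun h i
      simp only [scaleL, Matrix.mulVec_diagonal] at this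
      exact mul_left_cancel₀ (pow_ne_zero _ hγ.ne') this
    rw [Matrix.conjTranspose_eq_transpose_of_trivial, scaleL_transpose] at h
    exact h.smul hγ
  · have h1 := (isPLESolution_pascalP n).2
    set A := shiftA n
    set L := scaleL n γ
    set P := pascalP n
    set B := Matrix.vecMulVec (inputB n) (inputB n)
    have e1 : Aᵀ * (γ • (L * P * L)) = γ ^ 2 • (L * (Aᵀ * P) * L) := by
      rw [Matrix.mul_smul, ← Matrix.mul_assoc, ← Matrix.mul_assoc, hA']
      simp only [Matrix.smul_mul, smul_smul, Matrix.mul_assoc, sq]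
    have e2 : (γ • (L * P * L)) * A = γ ^ 2 • (L * (P * A) * L) := by
      rw [Matrix.smul_mul, Matrix.mul_assoc, hA]
      simp only [Matrix.mul_smul, smul_smul, Matrix.mul_assoc, sq]
    have e3 : (γ • (L * P * L)) * B * (γ • (L * P * L)) = γ ^ 2 • (L * (P * B * P) * L) := by
      simp only [Matrix.mul_smul, Matrix.smul_mul, smul_smul, sq]
      congr 1
      calc L * P * L * B * (L * P * L) = L * P * (L * B * L) * P * L := by
            simp only [Matrix.mul_assoc]
        _ = L * (P * B * P) * L := by rw [hB]; simp only [Matrix.mul_assoc]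
    rw [e1, e2, e3, ← smul_add, ← smul_sub, ← Matrix.add_mul, ← Matrix.sub_mul, ← Matrix.mul_add,
      ← Matrix.mul_sub, h1, one_smul, smul_smul, ← sq]
    simp

theorem pleP_eq (n : ℕ) {γ : ℝ} (hγ : 0 < γ) :
    pleP n γ = γ • (scaleL n γ * pascalP n * scaleL n γ) :=
  IsPLESolution.unique hγ.ne' (Classical.epsilon_spec ⟨_, isPLESolution_scaled n hγ⟩)
    (isPLESolution_scaled n hγ)

theorem pleP_one (n : ℕ) : pleP n 1 = pascalP n := by
  simp [pleP_eq n one_pos, scaleL]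

/-! ### Quadratic form estimates -/

/-- The spectrum is finite, so the supremum is a true upper bound and `λ_max·1 - H` has nonnegative
eigenvalues. -/
theorem dotProduct_mulVec_le_lambdaMax {n : ℕ} {H : Matrix (Fin n) (Fin n) ℝ}
    (hH : H.IsHermitian) (w : Fin n → ℝ) : w ⬝ᵥ (H *ᵥ w) ≤ lambdaMax H * (w ⬝ᵥ w) := by
  have hD : (algebraMap ℝ (Matrix (Fin n) (Fin n) ℝ) (lambdaMax H) - H).IsHermitian := by
    refine Matrix.IsHermitian.sub ?_ hH
    rw [Matrix.algebraMap_eq_diagonal]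
    exact Matrix.isHermitian_diagonal _
  have hps : (algebraMap ℝ (Matrix (Fin n) (Fin n) ℝ) (lambdaMax H) - H).PosSemidef := by
    rw [hD.posSemidef_iff_eigenvalues_nonneg]
    intro i
    have h1 := hD.eigenvalues_mem_spectrum_real i
    rw [← spectrum.singleton_sub_eq] at h1
    obtain ⟨a, ha, ν, hν, h2⟩ := h1
    rw [mem_singleton_iff] at ha
    have h3 : ν ≤ lambdaMax H := le_csSup Matrix.finite_real_spectrum.bddAbove hν
    simp only at h2
    rw [Pi.zero_apply, ← h2, ha]
    linarith
  have h := hps.re_dotProduct_nonneg w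
  rw [Matrix.sub_mulVec, Algebra.algebraMap_eq_smul_one, Matrix.smul_mulVec, Matrix.one_mulVec] at h
  simp only [star_trivial, dotProduct_sub, dotProduct_smul, smul_eq_mul, RCLike.re_to_real] at h
  linarith

/-- The quadratic form `yᵀ P(1) y`. -/
def energy {n : ℕ} (y : Fin n → ℝ) : ℝ := (signedPascal n *ᵥ y) ⬝ᵥ (signedPascal n *ᵥ y)

theorem dotProduct_pascalP_mulVec {n : ℕ} (y z : Fin n → ℝ) :
    y ⬝ᵥ (pascalP n *ᵥ z) = (signedPascal n *ᵥ y) ⬝ᵥ (signedPascal n *ᵥ z) := by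
  rw [pascalP, ← Matrix.mulVec_mulVec, Matrix.dotProduct_mulVec, Matrix.vecMul_transpose]

theorem pascalP_isHermitian (n : ℕ) : (pascalP n).IsHermitian := (pascalP_posDef n).1

theorem energy_nonneg {n : ℕ} (y : Fin n → ℝ) : 0 ≤ energy y := by
  rw [energy]
  exact Finset.sum_nonneg fun _ _ => mul_self_nonneg _

theorem energy_le {n : ℕ} (y : Fin n → ℝ) : energy y ≤ bigLambda n * (y ⬝ᵥ y) := by
  rw [energy, ← dotProduct_pascalP_mulVec, bigLambda, pleP_one]
  exact dotProduct_mulVec_le_lambdaMax (pascalP_isHermitian n) y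

/-- As `R` is an involution, the energy of `Ry` is `‖y‖²` and its squared norm is the energy of `y`:
the upper bound at `Ry` is the lower bound at `y`. -/
theorem dotProduct_self_le_energy {n : ℕ} (y : Fin n → ℝ) :
    y ⬝ᵥ y ≤ bigLambda n * energy y := by
  have := energy_le (signedPascal n *ᵥ y)
  rwa [energy, Matrix.mulVec_mulVec, signedPascal_mul_self, Matrix.one_mulVec] at this

theorem bigLambda_pos {n : ℕ} (hn : 1 ≤ n) : 0 < bigLambda n := by
  have h := dotProduct_self_le_energy (Pi.single (⟨0, hn⟩ : Fin n) 1)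
  rw [single_dotProduct, Pi.single_eq_same, one_mul] at h
  by_contra h0
  have := mul_nonpos_of_nonpos_of_nonneg (not_lt.mp h0)
    (energy_nonneg (Pi.single (⟨0, hn⟩ : Fin n) (1 : ℝ)))
  linarith

theorem dotProduct_sq_le {n : ℕ} (v w : Fin n → ℝ) : (v ⬝ᵥ w) ^ 2 ≤ (v ⬝ᵥ v) * (w ⬝ᵥ w) := by
  have := Finset.sum_mul_sq_le_sq_mul_sq Finset.univ v w
  simpa only [dotProduct, sq] using this

/-- Cauchy–Schwarz for the inner product of `P`; one `Λ` bounds the energy of `F`, the other returns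
from `‖y‖²` to the energy of `y`. -/
theorem dotProduct_pascalP_mulVec_le {n : ℕ} (hn : 1 ≤ n) {d : ℝ} (hd : 0 ≤ d) {y F : Fin n → ℝ}
    (h : F ⬝ᵥ F ≤ d ^ 2 * (y ⬝ᵥ y)) :
    y ⬝ᵥ (pascalP n *ᵥ F) ≤ d * bigLambda n * energy y := by
  have hΛ := (bigLambda_pos hn).le
  have hE := energy_nonneg y
  refine le_of_sq_le_sq ?_ (by positivity)
  rw [dotProduct_pascalP_mulVec]
  calc _ ≤ energy y * energy F := dotProduct_sq_le _ _
    _ ≤ energy y * (bigLambda n * (d ^ 2 * (bigLambda n * energy y))) := by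
        refine mul_le_mul_of_nonneg_left ((energy_le F).trans ?_) hE
        refine mul_le_mul_of_nonneg_left (h.trans ?_) hΛ
        exact mul_le_mul_of_nonneg_left (dotProduct_self_le_energy y) (sq_nonneg d)
    _ = _ := by ring

/-- The largest eigenvalue of `E_n + P_n E_n P_n⁻¹`. -/
def lambdaE (n : ℕ) : ℝ := lambdaMax (diagE n + pleP n 1 * diagE n * (pleP n 1)⁻¹)

theorem diagE_transpose (n : ℕ) : (diagE n)ᵀ = diagE n := Matrix.diagonal_transpose _

theorem two_mul_dotProduct_diagE_le {n : ℕ} (y : Fin n → ℝ) :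
    2 * (y ⬝ᵥ (pascalP n *ᵥ (diagE n *ᵥ y))) ≤ lambdaE n * energy y := by
  set R := signedPascal n with hR
  set E := diagE n with hE
  have hRR : R * R = 1 := signedPascal_mul_self n
  have hRT : Rᵀ * Rᵀ = 1 := signedPascal_transpose_mul_self n
  set G := R * E * R with hG
  have hGT : Gᵀ = Rᵀ * E * Rᵀ := by
    rw [hG, Matrix.transpose_mul, Matrix.transpose_mul, hE, diagE_transpose, Matrix.mul_assoc]
  have hH : (G + Gᵀ).IsHermitian := by
    rw [Matrix.IsHermitian, Matrix.conjTranspose_eq_transpose_of_trivial, Matrix.transpose_add,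
      Matrix.transpose_transpose, add_comm]
  have hinv : (pleP n 1)⁻¹ = R * Rᵀ := by
    rw [pleP_one]; exact Matrix.inv_eq_right_inv (pascalP_mul_inv n)
  -- `E + PEP⁻¹` is not symmetric, but conjugation by `Rᵀ` turns it into `G + Gᵀ`.
  have hspec : lambdaE n = lambdaMax (G + Gᵀ) := by
    let u : (Matrix (Fin n) (Fin n) ℝ)ˣ := ⟨Rᵀ, Rᵀ, hRT, hRT⟩
    rw [lambdaE, lambdaMax, lambdaMax, ← spectrum.units_conjugate (a := E + _) (u := u)]
    congr 2
    change Rᵀ * _ * Rᵀ = _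
    rw [hinv, pleP_one, pascalP, ← hR, hGT, hG, Matrix.mul_add, Matrix.add_mul, add_comm]
    congr 1
    calc Rᵀ * (Rᵀ * R * E * (R * Rᵀ)) * Rᵀ = (Rᵀ * Rᵀ) * (R * E * R) * (Rᵀ * Rᵀ) := by
          simp only [Matrix.mul_assoc]
      _ = _ := by rw [hRT, Matrix.one_mul, Matrix.mul_one]
  have h := dotProduct_mulVec_le_lambdaMax hH (R *ᵥ y)
  rw [← hspec] at h
  have e1 : (R *ᵥ y) ⬝ᵥ (G *ᵥ (R *ᵥ y)) = y ⬝ᵥ (pascalP n *ᵥ (E *ᵥ y)) := by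
    rw [dotProduct_pascalP_mulVec, hG, Matrix.mulVec_mulVec, Matrix.mul_assoc, hRR, Matrix.mul_one,
      ← Matrix.mulVec_mulVec]
  have e2 : (R *ᵥ y) ⬝ᵥ (Gᵀ *ᵥ (R *ᵥ y)) = (R *ᵥ y) ⬝ᵥ (G *ᵥ (R *ᵥ y)) := by
    rw [Matrix.dotProduct_mulVec, Matrix.vecMul_transpose, dotProduct_comm]
  rw [Matrix.add_mulVec, dotProduct_add, e2, e1] at h
  rw [energy]
  linarith

theorem diagE_mulVec_inputB (n : ℕ) : diagE n *ᵥ inputB n = 0 := by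
  ext i
  rw [diagE, Matrix.mulVec_diagonal]
  simp only [inputB, Pi.zero_apply]
  split_ifs with h
  · rw [show n - 1 - (i : ℕ) = 0 by omega]; simp
  · simp

/-- Test the preceding inequality on `b`, which `E` annihilates and whose energy is positive. -/
theorem lambdaE_nonneg {n : ℕ} (hn : 1 ≤ n) : 0 ≤ lambdaE n := by
  have h := two_mul_dotProduct_diagE_le (inputB n)
  rw [diagE_mulVec_inputB, Matrix.mulVec_zero, dotProduct_zero, mul_zero] at h
  have hb : 0 < inputB n ⬝ᵥ inputB n := by
    refine Finset.sum_pos' (fun _ _ => mul_self_nonneg _) ⟨⟨n - 1, by omega⟩, Finset.mem_univ _, ?_⟩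
    simp [inputB, Nat.sub_add_cancel hn]
  have h2 := dotProduct_self_le_energy (inputB n)
  have h3 : 0 < energy (inputB n) := by
    rcases (energy_nonneg (inputB n)).lt_or_eq with h | h
    · exact h
    · rw [← h] at h2; linarith
  exact nonneg_of_mul_nonneg_left h h3

/-- The Lyapunov equation at `γ = 1`, evaluated as a quadratic form. -/
theorem two_mul_dotProduct_shiftA {n : ℕ} (y : Fin n → ℝ) :
    2 * (y ⬝ᵥ (pascalP n *ᵥ (shiftA n *ᵥ y))) =
      (inputB n ⬝ᵥ (pascalP n *ᵥ y)) ^ 2 - energy y := by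
  have h := congrArg (fun X => y ⬝ᵥ (X *ᵥ y)) (isPLESolution_pascalP n).2
  have hPT : (pascalP n)ᵀ = pascalP n := pascalP_isHermitian n
  simp only [one_smul, Matrix.sub_mulVec, Matrix.add_mulVec, dotProduct_sub, dotProduct_add,
    Matrix.neg_mulVec, dotProduct_neg] at h
  have e1 : y ⬝ᵥ (((shiftA n)ᵀ * pascalP n) *ᵥ y) = y ⬝ᵥ (pascalP n *ᵥ (shiftA n *ᵥ y)) := by
    rw [← Matrix.mulVec_mulVec, Matrix.dotProduct_mulVec, Matrix.vecMul_transpose,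
      dotProduct_comm, Matrix.dotProduct_mulVec y, ← Matrix.mulVec_transpose, hPT]
  have e2 : y ⬝ᵥ ((pascalP n * Matrix.vecMulVec (inputB n) (inputB n) * pascalP n) *ᵥ y) =
      (inputB n ⬝ᵥ (pascalP n *ᵥ y)) ^ 2 := by
    rw [← Matrix.mulVec_mulVec, ← Matrix.mulVec_mulVec, Matrix.vecMulVec_mulVec]
    rw [Matrix.dotProduct_mulVec y, ← Matrix.mulVec_transpose, hPT]
    rw [dotProduct_smul, op_smul_eq_smul, smul_eq_mul, dotProduct_comm (pascalP n *ᵥ y), sq]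
  rw [e1, e2, ← Matrix.mulVec_mulVec, dotProduct_pascalP_mulVec y y] at h
  rw [energy]
  linarith

theorem exists_bilin_bound {n : ℕ} (M : Matrix (Fin n) (Fin n) ℝ) :
    ∃ K, 0 ≤ K ∧ ∀ y : Fin n → ℝ, |y ⬝ᵥ (M *ᵥ y)| ≤ K * (y ⬝ᵥ y) := by
  refine ⟨∑ i, ∑ j, |M i j|, by positivity, fun y => ?_⟩
  have hle : ∀ i, y i ^ 2 ≤ y ⬝ᵥ y := fun i => by
    rw [sq]
    exact Finset.single_le_sum (f := fun i => y i * y i) (fun _ _ => mul_self_nonneg _)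
      (Finset.mem_univ i)
  simp only [Matrix.mulVec, dotProduct, Finset.mul_sum]
  refine (Finset.abs_sum_le_sum_abs _ _).trans ?_
  rw [← Finset.mul_sum, Finset.sum_mul]
  refine Finset.sum_le_sum fun i _ => (Finset.abs_sum_le_sum_abs _ _).trans ?_
  rw [Finset.sum_mul]
  refine Finset.sum_le_sum fun j _ => ?_
  rw [show y i * (M i j * y j) = M i j * (y i * y j) by ring, abs_mul]
  refine mul_le_mul_of_nonneg_left ?_ (abs_nonneg _)
  have hi := hle i
  have hj := hle j
  simp only [dotProduct] at hi hj
  rw [abs_le]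
  constructor <;> nlinarith [sq_nonneg (y i + y j), sq_nonneg (y i - y j)]

/-! ### The gain and the feedback laws -/

theorem dConst_nonneg {n : ℕ} (T : ℝ) (c : Fin n → Fin n → ℝ) : 0 ≤ dConst T c :=
  Real.sqrt_nonneg _

theorem gainBeta_eq {n : ℕ} (hn : 1 ≤ n) (T c₀ : ℝ) (c : Fin n → Fin n → ℝ) :
    gainBeta T c₀ c =
      (3 + lambdaE n + 2 * dConst T c * bigLambda n) * Real.exp (|c₀| * T) := by
  have h0 : (n : ℝ) ≠ 0 := by positivity
  rw [gainBeta, deltaC, ← lambdaE]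
  field_simp
  ring

theorem gainFactor_nonneg {n : ℕ} (hn : 1 ≤ n) (T : ℝ) (c : Fin n → Fin n → ℝ) :
    0 ≤ 3 + lambdaE n + 2 * dConst T c * bigLambda n := by
  have h1 := lambdaE_nonneg hn
  have h2 := (bigLambda_pos hn).le
  have h3 := dConst_nonneg T c
  positivity

theorem gainBeta_nonneg {n : ℕ} (hn : 1 ≤ n) (T c₀ : ℝ) (c : Fin n → Fin n → ℝ) :
    0 ≤ gainBeta T c₀ c := by
  rw [gainBeta_eq hn]
  exact mul_nonneg (gainFactor_nonneg hn T c) (Real.exp_pos _).le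

theorem abs_mul_le_of_mem_Ico {c₀ t T : ℝ} (ht : t ∈ Ico 0 T) : |c₀ * t| ≤ |c₀| * T := by
  rw [abs_mul, abs_of_nonneg ht.1]
  exact mul_le_mul_of_nonneg_left ht.2.le (abs_nonneg _)

/-- The factor `e^{|c₀|T}` in the gain absorbs the worst value of `e^{c₀t}`. -/
theorem le_gainBeta_mul_exp {n : ℕ} (hn : 1 ≤ n) {T c₀ t : ℝ} (c : Fin n → Fin n → ℝ)
    (ht : t ∈ Ico 0 T) :
    3 + lambdaE n + 2 * dConst T c * bigLambda n ≤ gainBeta T c₀ c * Real.exp (c₀ * t) := by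
  rw [gainBeta_eq hn, mul_assoc _ (Real.exp _), ← Real.exp_add]
  refine le_mul_of_one_le_right (gainFactor_nonneg hn T c) (Real.one_le_exp ?_)
  have := (abs_le.mp (abs_mul_le_of_mem_Ico (c₀ := c₀) ht)).1
  linarith

/-- The doubly rescaled state `L_n(g)² x`. -/
def scaledState {n : ℕ} (g : ℝ) (x : Fin n → ℝ) : Fin n → ℝ :=
  fun i => g ^ (2 * (n - 1 - (i : ℕ))) * x i

theorem gammaFun_eq {T : ℝ} (hT : 0 < T) (t : ℝ) : gammaFun T t = (T - t)⁻¹ := by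
  rw [gammaFun]; field_simp

/-- In `P(g) = g L P(1) L` the outer `L` fixes `b`, and the inner one meets the explicit `L`, giving
`L²x`. This form also makes smoothness visible. -/
theorem feedbackU_eq {n : ℕ} {T t : ℝ} (hT : 0 < T) (ht : t < T) (c₀ : ℝ)
    (c : Fin n → Fin n → ℝ) (x : EuclideanSpace ℝ (Fin n)) :
    feedbackU T c₀ c t x = -(gainBeta T c₀ c * Real.exp (c₀ * t) * ((T - t)⁻¹ *
      (inputB n ⬝ᵥ (pascalP n *ᵥ scaledState (T - t)⁻¹ fun i => x i)))) := by
  have hg : 0 < (T - t)⁻¹ := inv_pos.mpr (sub_pos.mpr ht)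
  rw [feedbackU, gammaFun_eq hT, pleP_eq n hg, one_div]
  set g := (T - t)⁻¹
  have h1 : scaleL n g *ᵥ (scaleL n g *ᵥ fun i => x i) = scaledState g fun i => x i := by
    ext i
    simp only [scaleL, Matrix.mulVec_diagonal, scaledState]
    rw [two_mul, pow_add, mul_assoc]
  have h2 : ∀ v : Fin n → ℝ, inputB n ⬝ᵥ (scaleL n g *ᵥ v) = inputB n ⬝ᵥ v := fun v => by
    rw [Matrix.dotProduct_mulVec, ← Matrix.mulVec_transpose, scaleL_transpose,
      scaleL_mulVec_inputB]
  rw [Matrix.smul_mulVec, dotProduct_smul, ← Matrix.mulVec_mulVec, h1, ← Matrix.mulVec_mulVec, h2,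
    smul_eq_mul]

theorem contDiffOn_inv_sub {E : Type*} [NormedAddCommGroup E] [NormedSpace ℝ E] (T : ℝ) :
    ContDiffOn ℝ ∞ (fun p : ℝ × E => (T - p.1)⁻¹) (Ico 0 T ×ˢ univ) := by
  refine ContDiffOn.inv (by fun_prop) fun p hp => ?_
  exact (sub_pos.mpr hp.1.2).ne'

theorem contDiffOn_feedbackU0 {n : ℕ} (T c₀ : ℝ) (c : Fin n → Fin n → ℝ) :
    ContDiffOn ℝ ∞ (fun p : ℝ × ℝ => feedbackU0 T c₀ c p.1 p.2) (Ico 0 T ×ˢ univ) := by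
  simp only [feedbackU0, div_eq_mul_inv]
  have := contDiffOn_inv_sub (E := ℝ) T
  fun_prop

theorem contDiffOn_feedbackU {n : ℕ} {T : ℝ} (hT : 0 < T) (c₀ : ℝ) (c : Fin n → Fin n → ℝ) :
    ContDiffOn ℝ ∞ (fun p : ℝ × EuclideanSpace ℝ (Fin n) => feedbackU T c₀ c p.1 p.2)
      (Ico 0 T ×ˢ univ) := by
  refine ContDiffOn.congr ?_ fun p hp => feedbackU_eq hT hp.1.2 c₀ c p.2
  have := contDiffOn_inv_sub (E := EuclideanSpace ℝ (Fin n)) T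
  simp only [dotProduct, Matrix.mulVec, scaledState]
  fun_prop

/-! ### The `x₀`-subsystem -/

theorem hasDerivAt_inv_sub {T t : ℝ} (ht : t < T) :
    HasDerivAt (fun s => (T - s)⁻¹) ((T - t)⁻¹ ^ 2) t := by
  have h := ((hasDerivAt_id t).const_sub T).inv (sub_pos.mpr ht).ne'
  refine h.congr_deriv ?_
  rw [neg_neg, id_eq, inv_pow, one_div]

theorem x0_formula {n : ℕ} {T c₀ τ : ℝ} (hT : 0 < T) (hτ : τ ≤ T) {c : Fin n → Fin n → ℝ}
    {x₀ : ℝ → ℝ} (hx : ∀ t ∈ Ico 0 τ,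
      HasDerivWithinAt x₀ (feedbackU0 T c₀ c t (x₀ t) + c₀ * x₀ t) (Ico 0 τ) t)
    {t : ℝ} (ht : t ∈ Ico 0 τ) :
    x₀ t = (T - t) ^ 2 * Real.exp (c₀ * t) *
      ((T - t) * x₀ 0 / T ^ 3 - gainBeta T c₀ c * t / (2 * T)) := by
  have h0 : (0 : ℝ) ∈ Ico 0 τ := ⟨le_rfl, ht.1.trans_lt ht.2⟩
  set β := gainBeta T c₀ c with hβ
  have hd : ∀ s ∈ Ico 0 τ, HasDerivWithinAt
      (fun s => Real.exp (-(c₀ * s)) * (T - s)⁻¹ ^ 3 * x₀ s + β / 2 * (T - s)⁻¹) 0 (Ico 0 τ) s := by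
    intro s hs
    have hsT : s < T := hs.2.trans_le hτ
    have h1 : HasDerivAt (fun s => Real.exp (-(c₀ * s))) (Real.exp (-(c₀ * s)) * -c₀) s := by
      have := ((hasDerivAt_id s).const_mul c₀).neg.exp
      simpa using this
    have h2 := hasDerivAt_inv_sub hsT
    have h3 := ((h1.mul (h2.pow 3)).hasDerivWithinAt.mul (hx s hs)).add
      (h2.const_mul (β / 2)).hasDerivWithinAt
    refine h3.congr_deriv ?_
    have hne : T - s ≠ 0 := (sub_pos.mpr hsT).ne'
    have hexp : Real.exp (c₀ * s) * Real.exp (-(c₀ * s)) = 1 := by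
      rw [← Real.exp_add, add_neg_cancel, Real.exp_zero]
    simp only [Pi.mul_apply, Pi.pow_apply, feedbackU0, ← hβ, div_eq_mul_inv]
    have hg : (T - s) * (T - s)⁻¹ = 1 := mul_inv_cancel₀ hne
    set g := (T - s)⁻¹
    set e := Real.exp (-(c₀ * s))
    set e' := Real.exp (c₀ * s)
    norm_num
    linear_combination (-(β / 2) * g ^ 2 * ((T - s) * g)) * hexp - β / 2 * g ^ 2 * hg
  -- Zero derivative on an interval: the quantity keeps its value at 0.
  have hc := (convex_Ico 0 τ).norm_image_sub_le_of_norm_hasDerivWithin_le (C := 0) hd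
    (fun s _ => by simp) h0 ht
  rw [zero_mul, norm_le_zero_iff, sub_eq_zero] at hc
  simp only [mul_zero, neg_zero, Real.exp_zero, sub_zero, one_mul] at hc
  have hne : T - t ≠ 0 := (sub_pos.mpr (ht.2.trans_le hτ)).ne'
  rw [Real.exp_neg] at hc
  have hexp := (Real.exp_pos (c₀ * t)).ne'
  set e := Real.exp (c₀ * t)
  have h4 : x₀ t = e * (T - t) ^ 3 * (e⁻¹ * (T - t)⁻¹ ^ 3 * x₀ t) := by field_simp
  rw [h4, eq_sub_of_add_eq hc]
  field_simp
  ring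

/-- The coefficient of the quadratic correction in the closed-loop value of `u₀`. -/
def driftCoef (T β a : ℝ) : ℝ := 3 * (a / T ^ 3 + β / (2 * T))

/-- After rescaling, `u₀` is multiplied by `g²`: its leading term becomes `βeg`, matching the
strength of `u`, and its correction stays bounded. -/
theorem feedbackU0_formula {n : ℕ} {T c₀ t a : ℝ} (hT : 0 < T) (ht : t < T)
    (c : Fin n → Fin n → ℝ) {z : ℝ} (hz : z = (T - t) ^ 2 * Real.exp (c₀ * t) *
      ((T - t) * a / T ^ 3 - gainBeta T c₀ c * t / (2 * T))) :
    feedbackU0 T c₀ c t z = Real.exp (c₀ * t) * (T - t) *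
      (gainBeta T c₀ c - (T - t) * driftCoef T (gainBeta T c₀ c) a) := by
  have hne : T - t ≠ 0 := (sub_pos.mpr ht).ne'
  rw [hz, feedbackU0, driftCoef]
  field_simp
  ring

theorem abs_driftCoef_le {T β : ℝ} (hT : 0 < T) (hβ : 0 ≤ β) (a : ℝ) :
    |driftCoef T β a| ≤ driftCoef T β |a| := by
  rw [driftCoef, driftCoef, abs_mul, abs_of_pos (by norm_num : (0 : ℝ) < 3)]
  refine mul_le_mul_of_nonneg_left ((abs_add_le _ _).trans ?_) (by norm_num)
  rw [abs_div, abs_of_pos (by positivity : 0 < T ^ 3),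
    abs_of_nonneg (by positivity : 0 ≤ β / (2 * T))]

theorem abs_x0_le {T c₀ t a β : ℝ} (hT : 0 < T) (ht : t ∈ Ico 0 T) (hβ : 0 ≤ β) :
    |(T - t) ^ 2 * Real.exp (c₀ * t) * ((T - t) * a / T ^ 3 - β * t / (2 * T))| ≤
      (T - t) ^ 2 * Real.exp (c₀ * t) * ((T - t) * |a| / T ^ 3 + β * t / (2 * T)) := by
  have h1 : 0 < T - t := sub_pos.mpr ht.2
  have h2 := ht.1
  rw [abs_mul, abs_of_pos (by positivity : 0 < (T - t) ^ 2 * Real.exp (c₀ * t))]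
  refine mul_le_mul_of_nonneg_left ((abs_sub _ _).trans ?_) (by positivity)
  rw [abs_div, abs_mul, abs_of_pos h1, abs_of_pos (by positivity : 0 < T ^ 3),
    abs_of_nonneg (by positivity : 0 ≤ β * t / (2 * T))]

theorem abs_u0_le {T c₀ t a β : ℝ} (hT : 0 < T) (ht : t ∈ Ico 0 T) (hβ : 0 ≤ β) :
    |Real.exp (c₀ * t) * (T - t) * (β - (T - t) * driftCoef T β a)| ≤
      (T - t) * Real.exp (c₀ * t) * (3 * (T - t) * (|a| / T ^ 3 + β / (2 * T)) + β) := by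
  have h1 : 0 < T - t := sub_pos.mpr ht.2
  rw [abs_mul, abs_of_pos (by positivity : 0 < Real.exp (c₀ * t) * (T - t)),
    mul_comm (Real.exp _)]
  refine mul_le_mul_of_nonneg_left ((abs_sub _ _).trans ?_) (by positivity)
  rw [abs_mul, abs_of_pos h1, abs_of_nonneg hβ]
  have := mul_le_mul_of_nonneg_left (abs_driftCoef_le hT hβ a) h1.le
  have h2 : driftCoef T β |a| = 3 * (|a| / T ^ 3 + β / (2 * T)) := rfl
  rw [h2] at this
  linarith

/-! ### The energy along closed-loop solutions -/

theorem hasDerivWithinAt_energy {n : ℕ} {Y : ℝ → Fin n → ℝ} {v : Fin n → ℝ} {S : Set ℝ} {t : ℝ}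
    (h : ∀ i, HasDerivWithinAt (fun s => Y s i) (v i) S t) :
    HasDerivWithinAt (fun s => energy (Y s)) (2 * (Y t ⬝ᵥ (pascalP n *ᵥ v))) S t := by
  have h1 : ∀ k, HasDerivWithinAt (fun s => (signedPascal n *ᵥ Y s) k) ((signedPascal n *ᵥ v) k)
      S t := fun k => by
    simp only [Matrix.mulVec, dotProduct]
    exact HasDerivWithinAt.fun_sum fun j _ => (h j).const_mul _
  have h2 := HasDerivWithinAt.fun_sum (u := Finset.univ) fun k _ => (h1 k).mul (h1 k)
  refine h2.congr_deriv ?_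
  rw [dotProduct_pascalP_mulVec, dotProduct, Finset.mul_sum]
  refine Finset.sum_congr rfl fun k _ => ?_
  ring

theorem dotProduct_pascalP_comm {n : ℕ} (y z : Fin n → ℝ) :
    y ⬝ᵥ (pascalP n *ᵥ z) = z ⬝ᵥ (pascalP n *ᵥ y) := by
  rw [dotProduct_pascalP_mulVec, dotProduct_pascalP_mulVec, dotProduct_comm]

/-- The dissipation inequality for the rescaled closed loop. -/
theorem energy_derivative_le {n : ℕ} (hn : 1 ≤ n) {d K β e g k : ℝ} (hd : 0 ≤ d) (he : 0 ≤ e)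
    (hg : 0 ≤ g) (hβ : 3 + lambdaE n + 2 * d * bigLambda n ≤ β * e) {y F : Fin n → ℝ}
    (hF : F ⬝ᵥ F ≤ d ^ 2 * (y ⬝ᵥ y))
    (hK : |2 * (y ⬝ᵥ (pascalP n *ᵥ (shiftA n *ᵥ y)))| ≤ K * energy y) :
    2 * (y ⬝ᵥ (pascalP n *ᵥ ((e * (β * g - k)) • (shiftA n *ᵥ y) -
      (β * e * (g * (inputB n ⬝ᵥ (pascalP n *ᵥ y)))) • inputB n + g • (diagE n *ᵥ y + F)))) ≤
      (-3 * g + e * |k| * K) * energy y := by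
  have hA := two_mul_dotProduct_shiftA y
  have hE := two_mul_dotProduct_diagE_le y
  have hP := dotProduct_pascalP_mulVec_le hn hd hF
  have hen := energy_nonneg y
  simp only [Matrix.mulVec_add, Matrix.mulVec_sub, Matrix.mulVec_smul, dotProduct_add,
    dotProduct_sub, dotProduct_smul, smul_eq_mul, dotProduct_pascalP_comm y (inputB n)]
  set a := y ⬝ᵥ (pascalP n *ᵥ (shiftA n *ᵥ y))
  set q := inputB n ⬝ᵥ (pascalP n *ᵥ y)
  set p := y ⬝ᵥ (pascalP n *ᵥ (diagE n *ᵥ y))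
  set f := y ⬝ᵥ (pascalP n *ᵥ F)
  have hΛ := (bigLambda_pos hn).le
  have hl := lambdaE_nonneg hn
  have hβe : 0 ≤ β * e := by
    have : 0 ≤ 2 * d * bigLambda n := by positivity
    linarith
  have h1 : -(e * k) * (2 * a) ≤ e * |k| * (K * energy y) := by
    calc -(e * k) * (2 * a) ≤ |-(e * k) * (2 * a)| := le_abs_self _
      _ = e * |k| * |2 * a| := by rw [abs_mul, abs_neg, abs_mul, abs_of_nonneg he]
      _ ≤ _ := mul_le_mul_of_nonneg_left hK (by positivity)
  have h2 : g * (2 * p + 2 * f) ≤ g * ((lambdaE n + 2 * d * bigLambda n) * energy y) :=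
    mul_le_mul_of_nonneg_left (by linarith) hg
  have h3 : g * ((3 + lambdaE n + 2 * d * bigLambda n) * energy y) ≤ g * ((β * e) * energy y) :=
    mul_le_mul_of_nonneg_left (mul_le_mul_of_nonneg_right hβ hen) hg
  -- The shift brings `+βegq²` and the feedback `-2βegq²`; the net negative square is discarded.
  have h4 : 0 ≤ β * e * g * q ^ 2 := by positivity
  have h5 : β * e * g * (2 * a) = β * e * g * (q ^ 2 - energy y) := by rw [hA]
  linarith

/-- The derivative of the rescaled state. -/
theorem hasDerivWithinAt_scaledState {n : ℕ} {T t : ℝ} (ht : t < T) {S : Set ℝ}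
    {x : ℝ → EuclideanSpace ℝ (Fin n)} {i : Fin n} {v : ℝ}
    (h : HasDerivWithinAt (fun s => x s i) v S t) :
    HasDerivWithinAt (fun s => scaledState (T - s)⁻¹ (fun i => x s i) i)
      (2 * (n - 1 - (i : ℕ) : ℕ) * (T - t)⁻¹ * scaledState (T - t)⁻¹ (fun i => x t i) i +
        (T - t)⁻¹ ^ (2 * (n - 1 - (i : ℕ))) * v) S t := by
  simp only [scaledState]
  refine (((hasDerivAt_inv_sub ht).pow _).hasDerivWithinAt.mul h).congr_deriv ?_
  simp only [Pi.pow_apply]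
  -- The power rule has the truncated exponent `2m - 1`, so `m = 0` is separate.
  cases n - 1 - (i : ℕ) with
  | zero => simp
  | succ m =>
    rw [show 2 * (m + 1) - 1 = 2 * m + 1 by omega]
    push_cast
    ring

/-- The weights of the triangular bound on the rescaled nonlinearity. -/
def boundWeight {n : ℕ} (T : ℝ) (c : Fin n → Fin n → ℝ) (i j : Fin n) : ℝ :=
  gCoef T c i j * T ^ ((i : ℕ) - (j : ℕ))

/-- Cauchy–Schwarz on row `i`, which has `i + 1` terms in zero-based indexing, produces the factor
`i` in `d²`; exchanging the sums groups the weights by column. -/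
theorem sum_sq_le_dConst {n : ℕ} {T : ℝ} (c : Fin n → Fin n → ℝ)
    {y F : Fin n → ℝ} (h : ∀ i, |F i| ≤ ∑ j ∈ Finset.Iic i, boundWeight T c i j * |y j|) :
    F ⬝ᵥ F ≤ dConst T c ^ 2 * (y ⬝ᵥ y) := by
  set S : Fin n → ℝ := fun j => ∑ i ∈ Finset.Ici j,
    gCoef T c i j ^ 2 * ((i : ℕ) + 1 : ℝ) / (1 / T) ^ (2 * ((i : ℕ) - (j : ℕ))) with hS
  have hw : ∀ i j : Fin n, gCoef T c i j ^ 2 * ((i : ℕ) + 1 : ℝ) /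
      (1 / T) ^ (2 * ((i : ℕ) - (j : ℕ))) = (i + 1) * boundWeight T c i j ^ 2 := fun i j => by
    rw [boundWeight, one_div, inv_pow, div_inv_eq_mul, mul_comm 2, pow_mul]
    ring
  have hS0 : ∀ j, 0 ≤ S j := fun j => by
    refine Finset.sum_nonneg fun i _ => ?_
    rw [hw]; positivity
  have hd : dConst T c ^ 2 = ⨆ j, S j := Real.sq_sqrt (Real.iSup_nonneg hS0)
  have hSle : ∀ j, S j ≤ dConst T c ^ 2 := fun j => by
    rw [hd]; exact le_ciSup (Set.finite_range S).bddAbove j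
  have h1 : ∀ i, F i * F i ≤ ∑ j ∈ Finset.Iic i, (i + 1) * boundWeight T c i j ^ 2 * y j ^ 2 := by
    intro i
    have h2 : F i * F i ≤ (∑ j ∈ Finset.Iic i, boundWeight T c i j * |y j|) ^ 2 := by
      rw [← sq, ← sq_abs]
      exact pow_le_pow_left₀ (abs_nonneg _) (h i) 2
    refine h2.trans (sq_sum_le_card_mul_sum_sq.trans_eq ?_)
    rw [Finset.mul_sum, Fin.card_Iic]
    refine Finset.sum_congr rfl fun j _ => ?_
    rw [mul_pow, sq_abs]
    push_cast
    ring
  calc F ⬝ᵥ F ≤ ∑ i, ∑ j ∈ Finset.Iic i, (i + 1) * boundWeight T c i j ^ 2 * y j ^ 2 :=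
        Finset.sum_le_sum fun i _ => h1 i
    _ = ∑ j, ∑ i ∈ Finset.Ici j, (i + 1) * boundWeight T c i j ^ 2 * y j ^ 2 := by
        refine Finset.sum_comm' fun i j => ?_
        simp
    _ = ∑ j, S j * (y j * y j) := by
        refine Finset.sum_congr rfl fun j _ => ?_
        rw [hS, Finset.sum_mul]
        refine Finset.sum_congr rfl fun i _ => ?_
        rw [hw]; ring
    _ ≤ ∑ j, dConst T c ^ 2 * (y j * y j) :=
        Finset.sum_le_sum fun j _ => mul_le_mul_of_nonneg_right (hSle j) (mul_self_nonneg _)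
    _ = _ := by rw [dotProduct, Finset.mul_sum]

/-- Test the growth bound on a basis vector. The sign is needed to replace powers of `T - t` by
powers of `T`. -/
theorem AdmissibleNonlinearity.coef_nonneg {n : ℕ} {T : ℝ} (hT : 0 < T) {c : Fin n → Fin n → ℝ}
    {φ : Fin n → ℝ → ℝ → EuclideanSpace ℝ (Fin n) → ℝ} (hφ : AdmissibleNonlinearity T c φ)
    {i j : Fin n} (hij : j ≤ i) : 0 ≤ c i j := by
  have h := (hφ i).2 0 ⟨le_rfl, hT⟩ 0 (EuclideanSpace.single j 1)
  have h2 : ∑ k ∈ Finset.Iic i, c i k * |(EuclideanSpace.single j (1 : ℝ)) k| = c i j := by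
    rw [Finset.sum_eq_single j]
    · simp
    · intro k _ hk; simp [hk]
    · intro hj; exact absurd (Finset.mem_Iic.mpr hij) hj
  rw [h2] at h
  exact (abs_nonneg _).trans h

theorem abs_rescaled_nonlinearity_le {n : ℕ} {T t : ℝ} (ht : t ∈ Ico 0 T)
    {c : Fin n → Fin n → ℝ} {φ : Fin n → ℝ → ℝ → EuclideanSpace ℝ (Fin n) → ℝ}
    (hφ : AdmissibleNonlinearity T c φ) (u : ℝ) (x : EuclideanSpace ℝ (Fin n)) (i : Fin n) :
    |(n - 1 - (i : ℕ) : ℕ) * scaledState (T - t)⁻¹ (fun i => x i) i +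
      (T - t) * ((T - t)⁻¹ ^ (2 * (n - 1 - (i : ℕ))) * φ i t u x)| ≤
      ∑ j ∈ Finset.Iic i, boundWeight T c i j * |scaledState (T - t)⁻¹ (fun i => x i) j| := by
  have hT : 0 < T := ht.1.trans_lt ht.2
  have hr : 0 < T - t := sub_pos.mpr ht.2
  have hrT : T - t ≤ T := by linarith [ht.1]
  set y := scaledState (T - t)⁻¹ (fun i => x i) with hy
  have hxy : ∀ j, |x j| = (T - t) ^ (2 * (n - 1 - (j : ℕ))) * |y j| := fun j => by
    rw [hy, scaledState, abs_mul ((T - t)⁻¹ ^ _),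
      abs_of_pos (by positivity : 0 < (T - t)⁻¹ ^ (2 * (n - 1 - (j : ℕ)))), ← mul_assoc, ← mul_pow,
      mul_inv_cancel₀ hr.ne', one_pow, one_mul]
  -- The spare copy of `Ey` enters as a diagonal term of the row sum; it is the `n - i` in `g_ii`.
  have hm : |(n - 1 - (i : ℕ) : ℕ) * y i| =
      ∑ j ∈ Finset.Iic i, if j = i then ((n - 1 - (i : ℕ) : ℕ) : ℝ) * |y i| else 0 := by
    rw [Finset.sum_ite_eq' , if_pos (Finset.mem_Iic.mpr le_rfl), abs_mul, Nat.abs_cast]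
  have hp : |(T - t) * ((T - t)⁻¹ ^ (2 * (n - 1 - (i : ℕ))) * φ i t u x)| ≤
      ∑ j ∈ Finset.Iic i, (T - t) ^ (1 + 2 * ((i : ℕ) - j)) * (c i j * |y j|) := by
    rw [abs_mul, abs_mul, abs_of_pos hr,
      abs_of_pos (by positivity : 0 < (T - t)⁻¹ ^ (2 * (n - 1 - (i : ℕ))))]
    refine (mul_le_mul_of_nonneg_left (mul_le_mul_of_nonneg_left ((hφ i).2 t ht u x)
      (by positivity)) hr.le).trans_eq ?_
    rw [Finset.mul_sum, Finset.mul_sum]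
    refine Finset.sum_congr rfl fun j hj => ?_
    have hji : j ≤ i := Finset.mem_Iic.mp hj
    have hji' : (j : ℕ) ≤ i := hji
    have hin := i.2
    rw [hxy, show 2 * (n - 1 - (j : ℕ)) = 2 * (n - 1 - (i : ℕ)) + 2 * ((i : ℕ) - j) by omega,
      pow_add, pow_add, pow_one]
    have h1 : (T - t)⁻¹ ^ (2 * (n - 1 - (i : ℕ))) * (T - t) ^ (2 * (n - 1 - (i : ℕ))) = 1 := by
      rw [← mul_pow, inv_mul_cancel₀ hr.ne', one_pow]
    linear_combination ((T - t) * c i j * (T - t) ^ (2 * ((i : ℕ) - j)) * |y j|) * h1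
  refine (abs_add_le _ _).trans ((add_le_add hm.le hp).trans ?_)
  rw [← Finset.sum_add_distrib]
  refine Finset.sum_le_sum fun j hj => ?_
  have hji : j ≤ i := Finset.mem_Iic.mp hj
  have hc := hφ.coef_nonneg hT hji
  have hpow : (T - t) ^ (1 + 2 * ((i : ℕ) - j)) ≤ T ^ (1 + 2 * ((i : ℕ) - j)) :=
    pow_le_pow_left₀ hr.le hrT _
  have h3 := mul_le_mul_of_nonneg_right hpow (mul_nonneg hc (abs_nonneg (y j)))
  by_cases hij : j = i
  · subst hij
    have h4 : ((n - 1 - (j : ℕ) : ℕ) : ℝ) = (n : ℝ) - ((j : ℕ) + 1) := by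
      rw [Nat.sub_sub, Nat.cast_sub (by have := j.2; omega)]
      push_cast; ring
    simp only [boundWeight, gCoef, if_true, Nat.sub_self, mul_zero, add_zero, pow_one, pow_zero,
      mul_one] at h3 ⊢
    rw [h4]
    linarith
  · have hlt : (j : ℕ) < i := lt_of_le_of_ne hji fun h => hij (Fin.ext h)
    rw [if_neg hij, zero_add]
    refine h3.trans_eq ?_
    rw [boundWeight, gCoef, if_neg (Ne.symm hij), mul_assoc (c i j), ← pow_add,
      show (i : ℕ) + 1 - j + (i - j) = 1 + 2 * (i - j) by omega]
    ring

/-- Comparison with the solution of `w' = (-3/(T-t) + M) w`. -/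
theorem le_of_deriv_le_of_prescribed {T τ M : ℝ} (hτ : τ ≤ T) {V V' : ℝ → ℝ}
    (hV : ∀ t ∈ Ico 0 τ, HasDerivWithinAt V (V' t) (Ico 0 τ) t)
    (hle : ∀ t ∈ Ico 0 τ, V' t ≤ (-3 * (T - t)⁻¹ + M) * V t) {t : ℝ} (ht : t ∈ Ico 0 τ) :
    V t ≤ V 0 / T ^ 3 * (T - t) ^ 3 * Real.exp (M * t) := by
  have h0 : (0 : ℝ) ∈ Ico 0 τ := ⟨le_rfl, ht.1.trans_lt ht.2⟩
  -- The integrating factor `e^{-Ms}(T-s)⁻³` makes the inequality a monotonicity statement.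
  have hd : ∀ s ∈ Ico 0 τ, HasDerivWithinAt
      (fun s => Real.exp (-(M * s)) * (T - s)⁻¹ ^ 3 * V s)
      (Real.exp (-(M * s)) * (T - s)⁻¹ ^ 3 * (V' s - (-3 * (T - s)⁻¹ + M) * V s)) (Ico 0 τ) s := by
    intro s hs
    have hsT : s < T := hs.2.trans_le hτ
    have h1 : HasDerivAt (fun s => Real.exp (-(M * s))) (Real.exp (-(M * s)) * -M) s := by
      have := ((hasDerivAt_id s).const_mul M).neg.exp
      simpa using this
    refine ((h1.mul ((hasDerivAt_inv_sub hsT).pow 3)).hasDerivWithinAt.mul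
      (hV s hs)).congr_deriv ?_
    simp only [Pi.mul_apply, Pi.pow_apply]
    push_cast
    ring
  have hanti : AntitoneOn (fun s => Real.exp (-(M * s)) * (T - s)⁻¹ ^ 3 * V s) (Ico 0 τ) := by
    refine antitoneOn_of_hasDerivWithinAt_nonpos (convex_Ico 0 τ)
      (fun s hs => (hd s hs).continuousWithinAt)
      (fun s hs => (hd s (interior_subset hs)).mono interior_subset) fun s hs => ?_
    have hs' := interior_subset hs
    have hsT : 0 < T - s := sub_pos.mpr (hs'.2.trans_le hτ)
    exact mul_nonpos_of_nonneg_of_nonpos (by positivity) (sub_nonpos.mpr (hle s hs'))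
  have h := hanti h0 ht ht.1
  simp only [mul_zero, neg_zero, Real.exp_zero, sub_zero, one_mul] at h
  have hr : 0 < T - t := sub_pos.mpr (ht.2.trans_le hτ)
  have h2 := mul_le_mul_of_nonneg_left h
    (by positivity : 0 ≤ Real.exp (M * t) * (T - t) ^ 3)
  rw [Real.exp_neg] at h2
  have he := (Real.exp_pos (M * t)).ne'
  calc V t = Real.exp (M * t) * (T - t) ^ 3 * ((Real.exp (M * t))⁻¹ * (T - t)⁻¹ ^ 3 * V t) := by
        field_simp
    _ ≤ _ := h2
    _ = _ := by rw [inv_pow]; ring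

/-! ### Bounds for closed-loop solutions -/

/-- The rescaled closed-loop vector field. -/
theorem scaled_closedLoop_derivative {n : ℕ} {T t β e k q u₀ u : ℝ} (ht : t < T)
    (φ : Fin n → ℝ → ℝ → EuclideanSpace ℝ (Fin n) → ℝ) (x : EuclideanSpace ℝ (Fin n))
    (hu₀ : u₀ = e * (T - t) * (β - (T - t) * k)) (hu : u = -(β * e * ((T - t)⁻¹ * q)))
    (i : Fin n) :
    2 * (n - 1 - (i : ℕ) : ℕ) * (T - t)⁻¹ * scaledState (T - t)⁻¹ (fun i => x i) i +
        (T - t)⁻¹ ^ (2 * (n - 1 - (i : ℕ))) * chainedRHS φ t u₀ u x i =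
      ((e * (β * (T - t)⁻¹ - k)) • (shiftA n *ᵥ scaledState (T - t)⁻¹ fun i => x i) -
        (β * e * ((T - t)⁻¹ * q)) • inputB n +
        (T - t)⁻¹ • (diagE n *ᵥ (scaledState (T - t)⁻¹ fun i => x i) +
          fun i : Fin n => ((n - 1 - (i : ℕ) : ℕ) : ℝ) * scaledState (T - t)⁻¹ (fun i => x i) i +
            (T - t) * ((T - t)⁻¹ ^ (2 * (n - 1 - (i : ℕ))) * φ i t u x))) i := by
  have hg : (T - t) * (T - t)⁻¹ = 1 := mul_inv_cancel₀ (sub_pos.mpr ht).ne'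
  rw [chainedRHS]
  simp only [Pi.add_apply, Pi.sub_apply, Pi.smul_apply, smul_eq_mul, diagE, Matrix.mulVec_diagonal,
    shiftA_mulVec_apply, inputB]
  set r := T - t
  set g := r⁻¹
  have hi := i.2
  by_cases h : (i : ℕ) + 1 < n
  · rw [dif_pos h, dif_pos h, if_neg h.ne]
    -- Consecutive weights differ by `g²`, the factor that `u₀` acquires.
    have h1 : 2 * (n - 1 - (i : ℕ)) = 2 * (n - 1 - ((i : ℕ) + 1)) + 2 := by omega
    simp only [scaledState, hu₀]
    rw [h1, pow_add]
    set G := g ^ (2 * (n - 1 - ((i : ℕ) + 1)))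
    linear_combination (G * x ⟨i + 1, h⟩ * e * (g * β - k * (r * g + 1)) - G * g ^ 2 * φ i t u x) * hg
  · have h1 : (i : ℕ) + 1 = n := by omega
    have h2 : n - 1 - (i : ℕ) = 0 := by omega
    rw [dif_neg h, dif_neg h, if_pos h1, h2, hu]
    simp only [mul_zero, pow_zero, Nat.cast_zero]
    linear_combination (-φ i t (-(β * e * (g * q))) x) * hg

theorem energy_bound_of_solution {n : ℕ} (hn : 1 ≤ n) {T c₀ τ K : ℝ} (hτ : τ ≤ T)
    {c : Fin n → Fin n → ℝ} (hK0 : 0 ≤ K)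
    (hK : ∀ y : Fin n → ℝ, |2 * (y ⬝ᵥ (pascalP n *ᵥ (shiftA n *ᵥ y)))| ≤ K * energy y)
    {φ : Fin n → ℝ → ℝ → EuclideanSpace ℝ (Fin n) → ℝ} (hφ : AdmissibleNonlinearity T c φ)
    {x₀ : ℝ → ℝ} {x : ℝ → EuclideanSpace ℝ (Fin n)}
    (hx : IsClosedLoopSolution T c₀ c φ τ x₀ x) {t : ℝ} (ht : t ∈ Ico 0 τ) :
    energy (scaledState (T - t)⁻¹ fun i => x t i) ≤
      energy (scaledState T⁻¹ fun i => x 0 i) / T ^ 3 * (T - t) ^ 3 *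
        Real.exp (Real.exp (|c₀| * T) * driftCoef T (gainBeta T c₀ c) |x₀ 0| * K * t) := by
  have hT : 0 < T := (ht.1.trans_lt ht.2).trans_le hτ
  have hmem : ∀ s ∈ Ico 0 τ, s ∈ Ico 0 T := fun s hs => ⟨hs.1, hs.2.trans_le hτ⟩
  set β := gainBeta T c₀ c with hβ
  have h := le_of_deriv_le_of_prescribed (M := Real.exp (|c₀| * T) * driftCoef T β |x₀ 0| * K)
    hτ (V := fun s => energy (scaledState (T - s)⁻¹ fun i => x s i))
    (fun s hs => hasDerivWithinAt_energy
      (Y := fun s => scaledState (T - s)⁻¹ fun i => x s i)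
      fun i => hasDerivWithinAt_scaledState (hmem s hs).2 ((hx s hs).2 i))
    (fun s hs => ?_) ht
  · simpa only [sub_zero] using h
  · have hsT := hmem s hs
    have hu₀ := feedbackU0_formula hT hsT.2 c (x0_formula hT hτ (fun s hs => (hx s hs).1) hs)
    have hu := feedbackU_eq hT hsT.2 c₀ c (x s)
    have hv := funext fun i => scaled_closedLoop_derivative hsT.2 φ (x s) hu₀ hu i
    have hg : 0 < (T - s)⁻¹ := inv_pos.mpr (sub_pos.mpr hsT.2)
    simp only at hv ⊢
    rw [hv]
    refine (energy_derivative_le hn (dConst_nonneg T c) (Real.exp_pos _).le hg.le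
      (le_gainBeta_mul_exp hn c hsT) (sum_sq_le_dConst c
        fun i => abs_rescaled_nonlinearity_le hsT hφ _ (x s) i) (hK _)).trans ?_
    refine mul_le_mul_of_nonneg_right ?_ (energy_nonneg _)
    have h1 : Real.exp (c₀ * s) ≤ Real.exp (|c₀| * T) :=
      Real.exp_le_exp.mpr ((le_abs_self _).trans (abs_mul_le_of_mem_Ico hsT))
    have h2 := abs_driftCoef_le hT (gainBeta_nonneg hn T c₀ c) (x₀ 0)
    have h3 := mul_le_mul_of_nonneg_right
      (mul_le_mul h1 h2 (abs_nonneg _) (Real.exp_pos _).le) hK0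
    linarith

theorem exists_shift_bound {n : ℕ} (hn : 1 ≤ n) :
    ∃ K, 0 < K ∧ ∀ y : Fin n → ℝ,
      |2 * (y ⬝ᵥ (pascalP n *ᵥ (shiftA n *ᵥ y)))| ≤ K * energy y := by
  obtain ⟨K, hK0, hK⟩ := exists_bilin_bound (pascalP n * shiftA n)
  have hΛ := bigLambda_pos hn
  -- The added 1 makes the constant positive, as the exponential rate must be.
  refine ⟨2 * K * bigLambda n + 1, by positivity, fun y => ?_⟩
  have h1 := hK y
  rw [← Matrix.mulVec_mulVec] at h1
  rw [abs_mul, abs_two]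
  have h2 := mul_le_mul_of_nonneg_left (dotProduct_self_le_energy y) hK0
  have := energy_nonneg y
  linarith

theorem scaledState_dotProduct_le {n : ℕ} {g G : ℝ} (hg : 0 ≤ g) (hgG : g ≤ G) (hG : 1 ≤ G)
    (x : Fin n → ℝ) : scaledState g x ⬝ᵥ scaledState g x ≤ (G ^ (2 * n)) ^ 2 * (x ⬝ᵥ x) := by
  rw [dotProduct, dotProduct, Finset.mul_sum]
  refine Finset.sum_le_sum fun i _ => ?_
  have h1 : g ^ (2 * (n - 1 - (i : ℕ))) ≤ G ^ (2 * n) :=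
    (pow_le_pow_left₀ hg hgG _).trans (pow_le_pow_right₀ hG (by omega))
  have h2 := pow_le_pow_left₀ (by positivity) h1 2
  calc _ = (g ^ (2 * (n - 1 - (i : ℕ)))) ^ 2 * (x i * x i) := by rw [scaledState]; ring
    _ ≤ _ := mul_le_mul_of_nonneg_right h2 (mul_self_nonneg _)

theorem scaledState_inv {n : ℕ} {r : ℝ} (hr : r ≠ 0) (x : Fin n → ℝ) :
    scaledState r (scaledState r⁻¹ x) = x := by
  ext i
  rw [scaledState, scaledState, ← mul_assoc, ← mul_pow, mul_inv_cancel₀ hr, one_pow, one_mul]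

theorem norm_sq_eq_dotProduct {n : ℕ} (x : EuclideanSpace ℝ (Fin n)) :
    ‖x‖ ^ 2 = (fun i => x i) ⬝ᵥ (fun i => x i) := by
  rw [EuclideanSpace.real_norm_sq_eq, dotProduct]
  exact Finset.sum_congr rfl fun i _ => sq _

/-- Energy decay, expressed in the unscaled initial state. -/
theorem exists_energy_decay {n : ℕ} (hn : 1 ≤ n) {T : ℝ} (hT : 0 < T) (c₀ : ℝ)
    (c : Fin n → Fin n → ℝ) :
    ∃ C υ : ℝ, 0 < C ∧ 0 < υ ∧ ∀ φ, AdmissibleNonlinearity T c φ →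
      ∀ (x₀ : ℝ → ℝ) (x : ℝ → EuclideanSpace ℝ (Fin n)), ∀ τ ≤ T,
        IsClosedLoopSolution T c₀ c φ τ x₀ x → ∀ t ∈ Ico 0 τ,
          energy (scaledState (T - t)⁻¹ fun i => x t i) ≤
            C * (T - t) ^ 3 * Real.exp (υ * |x₀ 0| * t) ^ 2 * ‖x 0‖ ^ 2 := by
  obtain ⟨K, hK0, hK⟩ := exists_shift_bound hn
  set β := gainBeta T c₀ c with hβ
  have hβ0 : 0 ≤ β := gainBeta_nonneg hn T c₀ c
  have hΛ := bigLambda_pos hn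
  set e := Real.exp (|c₀| * T) with he
  have he0 : 0 < e := Real.exp_pos _
  set B := bigLambda n * (((1 + T⁻¹) ^ (2 * n)) ^ 2) with hB
  -- The drift exponent is affine in `|x₀(0)|`: its constant part is bounded over `[0, T]` and goes
  -- into `C`; the rate of the other part is halved because the exponential appears squared.
  refine ⟨B / T ^ 3 * Real.exp (e * (3 * (β / (2 * T))) * K * T), e * 3 * K / (2 * T ^ 3),
    by positivity, by positivity, fun φ hφ x₀ x τ hτ hx t ht => ?_⟩
  have h1 := energy_bound_of_solution hn hτ hK0.le hK hφ hx ht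
  refine h1.trans ?_
  have hr : 0 < T - t := sub_pos.mpr (ht.2.trans_le hτ)
  have hT' := inv_pos.mpr hT
  have h2 : energy (scaledState T⁻¹ fun i => x 0 i) ≤ B * ‖x 0‖ ^ 2 := by
    rw [norm_sq_eq_dotProduct, hB, mul_assoc]
    refine (energy_le _).trans (mul_le_mul_of_nonneg_left ?_ hΛ.le)
    exact scaledState_dotProduct_le hT'.le (by linarith) (by linarith) _
  have h3 : Real.exp (e * driftCoef T β |x₀ 0| * K * t) ≤
      Real.exp (e * (3 * (β / (2 * T))) * K * T) *
        Real.exp (e * 3 * K / (2 * T ^ 3) * |x₀ 0| * t) ^ 2 := by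
    rw [← Real.exp_nat_mul, ← Real.exp_add, Real.exp_le_exp, driftCoef]
    have h4 : e * (3 * (β / (2 * T))) * K * t ≤ e * (3 * (β / (2 * T))) * K * T :=
      mul_le_mul_of_nonneg_left (ht.2.le.trans hτ) (by positivity)
    have h5 : e * (3 * (|x₀ 0| / T ^ 3 + β / (2 * T))) * K * t = e * (3 * (β / (2 * T))) * K * t +
        ((2 : ℕ) : ℝ) * (e * 3 * K / (2 * T ^ 3) * |x₀ 0| * t) := by
      push_cast
      field_simp
      ring
    linarith
  have h6 : energy (scaledState T⁻¹ fun i => x 0 i) / T ^ 3 * (T - t) ^ 3 ≤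
      B * ‖x 0‖ ^ 2 / T ^ 3 * (T - t) ^ 3 := by gcongr
  refine (mul_le_mul h6 h3 (Real.exp_pos _).le (by positivity)).trans_eq ?_
  ring

theorem exists_solution_bounds {n : ℕ} (hn : 1 ≤ n) {T : ℝ} (hT : 0 < T) (c₀ : ℝ)
    (c : Fin n → Fin n → ℝ) :
    ∃ a b υ : ℝ, 0 < a ∧ 0 < b ∧ 0 < υ ∧ ∀ φ, AdmissibleNonlinearity T c φ →
      ∀ (x₀ : ℝ → ℝ) (x : ℝ → EuclideanSpace ℝ (Fin n)), ∀ τ ≤ T,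
        IsClosedLoopSolution T c₀ c φ τ x₀ x → ∀ t ∈ Ico 0 τ,
          ‖x t‖ ≤ a * (T - t) ^ (3 / 2 : ℝ) * Real.exp (υ * |x₀ 0| * t) * ‖x 0‖ ∧
          |feedbackU T c₀ c t (x t)| ≤
            b * (T - t) ^ (1 / 2 : ℝ) * Real.exp (υ * |x₀ 0| * t) * ‖x 0‖ := by
  obtain ⟨C, υ, hC, hυ, h⟩ := exists_energy_decay hn hT c₀ c
  have hΛ := bigLambda_pos hn
  have hβ0 : 0 ≤ gainBeta T c₀ c := gainBeta_nonneg hn T c₀ c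
  set β := gainBeta T c₀ c with hβ
  set e := Real.exp (|c₀| * T) with he
  have he0 : 0 < e := Real.exp_pos _
  have hEb := energy_nonneg (inputB n)
  -- The first factor bounds the entries of `L_n(T-t)²`, which recovers `x` from `y`; the added 1
  -- ensures positivity of the second constant.
  refine ⟨(1 + T) ^ (2 * n) * Real.sqrt (bigLambda n * C),
    β * e * Real.sqrt (energy (inputB n) * C) + 1, υ, by positivity, by positivity, hυ,
    fun φ hφ x₀ x τ hτ hx t ht => ?_⟩
  have hE := h φ hφ x₀ x τ hτ hx t ht
  have htT : t ∈ Ico 0 T := ⟨ht.1, ht.2.trans_le hτ⟩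
  have hr : 0 < T - t := sub_pos.mpr htT.2
  have h32 : ((T - t) ^ (3 / 2 : ℝ)) ^ 2 = (T - t) ^ 3 := by
    rw [← Real.rpow_natCast, ← Real.rpow_mul hr.le, ← Real.rpow_natCast]
    norm_num
  have h12 : ((T - t) ^ (1 / 2 : ℝ)) ^ 2 = T - t := by
    rw [← Real.rpow_natCast, ← Real.rpow_mul hr.le]
    norm_num
  set y := scaledState (T - t)⁻¹ fun i => x t i with hy
  set ε := Real.exp (υ * |x₀ 0| * t)
  have hε : 0 < ε := Real.exp_pos _
  have hp32 : 0 < (T - t) ^ (3 / 2 : ℝ) := Real.rpow_pos_of_pos hr _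
  have hp12 : 0 < (T - t) ^ (1 / 2 : ℝ) := Real.rpow_pos_of_pos hr _
  constructor
  · refine le_of_sq_le_sq ?_ (by positivity)
    have h1 : (fun i => x t i) = scaledState (T - t) y := (scaledState_inv hr.ne' _).symm
    rw [norm_sq_eq_dotProduct, h1]
    calc _ ≤ ((1 + T) ^ (2 * n)) ^ 2 * (y ⬝ᵥ y) :=
          scaledState_dotProduct_le hr.le (by linarith [ht.1]) (by linarith) y
      _ ≤ ((1 + T) ^ (2 * n)) ^ 2 * (bigLambda n * (C * (T - t) ^ 3 * ε ^ 2 * ‖x 0‖ ^ 2)) := by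
          refine mul_le_mul_of_nonneg_left ?_ (by positivity)
          exact (dotProduct_self_le_energy y).trans (mul_le_mul_of_nonneg_left hE hΛ.le)
      _ = _ := by
          rw [mul_pow, mul_pow, mul_pow, mul_pow, Real.sq_sqrt (by positivity), h32]
          ring
  · have h1 : |inputB n ⬝ᵥ (pascalP n *ᵥ y)| ≤
        Real.sqrt (energy (inputB n) * C) * ((T - t) ^ (3 / 2 : ℝ) * ε * ‖x 0‖) := by
      refine le_of_sq_le_sq ?_ (by positivity)
      rw [sq_abs, dotProduct_pascalP_mulVec]
      refine (dotProduct_sq_le _ _).trans ?_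
      refine (mul_le_mul_of_nonneg_left hE hEb).trans_eq ?_
      rw [mul_pow, mul_pow, mul_pow, Real.sq_sqrt (by positivity), h32]
      ring
    have h2 : (T - t)⁻¹ * (T - t) ^ (3 / 2 : ℝ) = (T - t) ^ (1 / 2 : ℝ) := by
      rw [← Real.rpow_neg_one, ← Real.rpow_add hr]
      norm_num
    have h3 : Real.exp (c₀ * t) ≤ e :=
      Real.exp_le_exp.mpr ((le_abs_self _).trans (abs_mul_le_of_mem_Ico htT))
    rw [feedbackU_eq hT htT.2, abs_neg, ← hβ, abs_mul, abs_mul, abs_mul, abs_of_nonneg hβ0,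
      Real.abs_exp, abs_of_pos (inv_pos.mpr hr)]
    calc β * Real.exp (c₀ * t) * ((T - t)⁻¹ * |inputB n ⬝ᵥ (pascalP n *ᵥ y)|) ≤
          β * e * ((T - t)⁻¹ *
            (Real.sqrt (energy (inputB n) * C) * ((T - t) ^ (3 / 2 : ℝ) * ε * ‖x 0‖))) := by
          gcongr
      _ = β * e * Real.sqrt (energy (inputB n) * C) *
            ((T - t)⁻¹ * (T - t) ^ (3 / 2 : ℝ)) * ε * ‖x 0‖ := by ring
      _ = β * e * Real.sqrt (energy (inputB n) * C) * (T - t) ^ (1 / 2 : ℝ) * ε * ‖x 0‖ := by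
          rw [h2]
      _ ≤ _ := by gcongr; linarith

theorem tendsto_zero_of_prescribed_bound {E : Type*} [NormedAddCommGroup E] {T : ℝ} (hT : 0 < T)
    {f : ℝ → E} {B : ℝ → ℝ} (hf : ∀ t ∈ Ico 0 T, ‖f t‖ ≤ B t) (hB : ContinuousAt B T)
    (hB0 : B T = 0) : Tendsto f (𝓝[<] T) (𝓝 0) := by
  refine squeeze_zero_norm' ?_ (hB0 ▸ hB.tendsto.mono_left nhdsWithin_le_nhds)
  filter_upwards [Ico_mem_nhdsLT hT] with t ht using hf t ht

end

end PrescribedTime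

theorem mainTheorem2 (n : ℕ) (hn : 1 ≤ n) (T : ℝ) (hT : 0 < T) (c₀ : ℝ)
    (c : Fin n → Fin n → ℝ) :
    ContDiffOn ℝ ∞ (fun p : ℝ × ℝ => feedbackU0 T c₀ c p.1 p.2) (Ico 0 T ×ˢ univ) ∧
    ContDiffOn ℝ ∞ (fun p : ℝ × EuclideanSpace ℝ (Fin n) => feedbackU T c₀ c p.1 p.2)
      (Ico 0 T ×ˢ univ) ∧
    ∃ υ₁₁ υ₁₂ υ₂₁ υ₂₂ : ℝ, 0 < υ₁₁ ∧ 0 < υ₁₂ ∧ 0 < υ₂₁ ∧ 0 < υ₂₂ ∧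
      ∀ φ : Fin n → ℝ → ℝ → EuclideanSpace ℝ (Fin n) → ℝ, AdmissibleNonlinearity T c φ →
      ∀ (x₀ : ℝ → ℝ) (x : ℝ → EuclideanSpace ℝ (Fin n)),
        (∀ τ ≤ T, IsClosedLoopSolution T c₀ c φ τ x₀ x → ∀ t ∈ Ico 0 τ,
          |x₀ t| ≤ (T - t) ^ 2 * Real.exp (c₀ * t) *
              ((T - t) * |x₀ 0| / T ^ 3 + gainBeta T c₀ c * t / (2 * T)) ∧
          |feedbackU0 T c₀ c t (x₀ t)| ≤ (T - t) * Real.exp (c₀ * t) *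
              (3 * (T - t) * (|x₀ 0| / T ^ 3 + gainBeta T c₀ c / (2 * T)) + gainBeta T c₀ c) ∧
          ‖x t‖ ≤ υ₁₁ * (T - t) ^ (3 / 2 : ℝ) * Real.exp (υ₁₂ * |x₀ 0| * t) * ‖x 0‖ ∧
          |feedbackU T c₀ c t (x t)| ≤
              υ₂₁ * (T - t) ^ (1 / 2 : ℝ) * Real.exp (υ₂₂ * |x₀ 0| * t) * ‖x 0‖) ∧
        (IsClosedLoopSolution T c₀ c φ T x₀ x →
          Tendsto x₀ (𝓝[<] T) (𝓝 0) ∧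
          Tendsto x (𝓝[<] T) (𝓝 0) ∧
          Tendsto (fun t => feedbackU0 T c₀ c t (x₀ t)) (𝓝[<] T) (𝓝 0) ∧
          Tendsto (fun t => feedbackU T c₀ c t (x t)) (𝓝[<] T) (𝓝 0)) := by
  refine ⟨contDiffOn_feedbackU0 T c₀ c, contDiffOn_feedbackU hT c₀ c, ?_⟩
  obtain ⟨a, b, υ, ha, hb, hυ, h⟩ := exists_solution_bounds hn hT c₀ c
  refine ⟨a, υ, b, υ, ha, hυ, hb, hυ, fun φ hφ x₀ x => ?_⟩
  have hβ := gainBeta_nonneg hn T c₀ c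
  have key : ∀ τ ≤ T, IsClosedLoopSolution T c₀ c φ τ x₀ x → ∀ t ∈ Ico 0 τ,
      |x₀ t| ≤ (T - t) ^ 2 * Real.exp (c₀ * t) *
          ((T - t) * |x₀ 0| / T ^ 3 + gainBeta T c₀ c * t / (2 * T)) ∧
      |feedbackU0 T c₀ c t (x₀ t)| ≤ (T - t) * Real.exp (c₀ * t) *
          (3 * (T - t) * (|x₀ 0| / T ^ 3 + gainBeta T c₀ c / (2 * T)) + gainBeta T c₀ c) ∧
      ‖x t‖ ≤ a * (T - t) ^ (3 / 2 : ℝ) * Real.exp (υ * |x₀ 0| * t) * ‖x 0‖ ∧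
      |feedbackU T c₀ c t (x t)| ≤
          b * (T - t) ^ (1 / 2 : ℝ) * Real.exp (υ * |x₀ 0| * t) * ‖x 0‖ := by
    intro τ hτ hx t ht
    have htT : t ∈ Ico 0 T := ⟨ht.1, ht.2.trans_le hτ⟩
    have hz := x0_formula hT hτ (fun s hs => (hx s hs).1) ht
    refine ⟨?_, ?_, h φ hφ x₀ x τ hτ hx t ht⟩
    · rw [hz]; exact abs_x0_le hT htT hβ
    · rw [feedbackU0_formula hT htT.2 c hz]; exact abs_u0_le hT htT hβ
  refine ⟨key, fun hx => ?_⟩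
  have hk := key T le_rfl hx
  -- The base vanishes at `T`, so continuity there relies on a positive exponent.
  have hrp : ∀ p : ℝ, 0 < p → ContinuousAt (fun t => (T - t) ^ p) T := fun p hp =>
    (continuous_const.sub continuous_id).continuousAt.rpow_const (Or.inr hp.le)
  refine ⟨tendsto_zero_of_prescribed_bound hT (fun t ht => (hk t ht).1)
      (Continuous.continuousAt (by fun_prop)) (by simp),
    tendsto_zero_of_prescribed_bound hT (fun t ht => (hk t ht).2.2.1) ?_ ?_,
    tendsto_zero_of_prescribed_bound hT (fun t ht => (hk t ht).2.1)
      (Continuous.continuousAt (by fun_prop)) (by simp),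
    tendsto_zero_of_prescribed_bound hT (fun t ht => (hk t ht).2.2.2) ?_ ?_⟩
  · have := hrp (3 / 2) (by norm_num)
    fun_prop
  · rw [sub_self, Real.zero_rpow (by norm_num)]; simp
  · have := hrp (1 / 2) (by norm_num)
    fun_prop
  · rw [sub_self, Real.zero_rpow (by norm_num)]; simp
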